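/- Paging with $n$ pages and a cache of size $k$, $1\le k\le n$, is the following metrical task system. A state is a set $C$ of exactly $k$ pages; moving between states $C$ and $C'$ costs $d(C,C')=|C\setminus C'|$; serving a request for page $i$ in state $C$ costs $\ell_i(C)=0$ if $i\in C$ and $\ell_i(C)=2$ if $i\notin C$. The horizon $T$ is known in advance and the request sequence $i_1,\dots,i_T$ is fixed by an oblivious adversary. At time $t$ a randomized online algorithm sees $i_t$ and then chooses a state $C_t$, depending on $i_1,\dots,i_t$ and on its internal randomness. Running time is not restricted. Theorem. There is an absolute constant $c>0$ such that for all $1\le k\le n$ there is a randomized online paging algorithm (that is, one algorithm for every horizon $T$) with the following two properties. (1) Its competitive ratio is $2H_k$, where $H_k=\sum_{j=1}^k\frac1j$: there is a constant $\beta>0$, independent of $T$, such that for every $T$ and every request sequence, $$\mathbb{E}\Big[\sum_{t=1}^T\ell_{i_t}(C_t)+\sum_{t=2}^Td(C_t,C_{t-1})\Big]\le 2H_k\min_{C^*_1,\dots,C^*_T}\Big(\sum_{t=1}^T\ell_{i_t}(C^*_t)+\sum_{t=2}^Td(C^*_t,C^*_{t-1})\Big)+\beta .$$ (2) For every $T\ge1$,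 every interval $I=\{t_0+1,\dots,t_0+m\}\subseteq\{1,\dots,T\}$ with $m\ge 1$, and every request sequence, $$\mathbb{E}\Big[\sum_{t\in I}\ell_{i_t}(C_t)+\sum_{t\in I\setminus\{t_0+1\}}d(C_t,C_{t-1})\Big]\le \min_{C}\sum_{t\in I}\ell_{i_t}(C)+c\Big(k\sqrt{|I|\log T}+\sqrt{k|I|\log\big(\tbinom nkT\big)}\Big),$$ and moreover $$k\sqrt{|I|\log T}+\sqrt{k|I|\log\big(\tbinom nkT\big)}\le c\,k\sqrt{|I|\log(nT)},$$ so the regret on $I$ is $O\big(k\sqrt{|I|\log(nT)}\big)$. -/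

import Mathlib

open MeasureTheory

/-- States of the paging system: the full caches, i.e. the `k`-subsets of the `n` pages. -/
abbrev Cache (n k : ℕ) : Type := {C : Finset (Fin n) // C.card = k}

namespace Paging

/-- Cost of moving between two caches: the number of pages that have to be fetched.
As both caches have `k` pages, this is symmetric. -/
def moveCost {n k : ℕ} (C C' : Cache n k) : ℝ := ((C.1 \ C'.1).card : ℝ)

/-- Cost of serving a request for page `i` while being in cache `C`: nothing on a hit, and two on
a miss (fetch `i` in place of some page of `C`, then fetch that page back). -/
def missLoss {n k : ℕ} (i : Fin n) (C : Cache n k) : ℝ := if i ∈ C.1 then 0 else 2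

/-- Total cost, on the time interval `{t₀ + 1, …, t₀ + m}`, of being in cache `S t` at time `t`,
when page `r t` is requested at time `t`. The move into the first cache of the interval is
not charged. -/
def cost {n k : ℕ} (r : ℕ → Fin n) (S : ℕ → Cache n k) (t₀ m : ℕ) : ℝ :=
  ∑ t ∈ Finset.Icc (t₀ + 1) (t₀ + m), missLoss (r t) (S t) +
    ∑ t ∈ Finset.Icc (t₀ + 2) (t₀ + m), moveCost (S t) (S (t - 1))

/-- The list `[r 1, …, r t]` of the requests revealed up to and including time `t`. -/
def history {n : ℕ} (r : ℕ → Fin n) (t : ℕ) : List (Fin n) :=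
  (List.range t).map fun s => r (s + 1)

/-- A randomized online paging algorithm: a random (with internal randomness `ω`) map that assigns
to the list of all requests seen so far, including the current one, the cache used now. -/
structure Algorithm (n k : ℕ) where
  Ω : Type
  [mΩ : MeasurableSpace Ω]
  μ : Measure Ω
  [isProb : IsProbabilityMeasure μ]
  act : List (Fin n) → Ω → Cache n k
  measurable_act : ∀ (h : List (Fin n)) (C : Cache n k), MeasurableSet {ω | act h ω = C}

attribute [instance] Algorithm.mΩ Algorithm.isProb

/-- The caches used by the algorithm when run on the request sequence `r` with randomness `ω`. -/
def Algorithm.run {n k : ℕ} (A : Algorithm n k) (r : ℕ → Fin n) (ω : A.Ω) (t : ℕ) : Cache n k :=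
  A.act (history r t) ω

/-- Expected cost of the algorithm on `{t₀ + 1, …, t₀ + m}`, for a fixed (oblivious) request
sequence `r`. -/
noncomputable def Algorithm.expectedCost {n k : ℕ} (A : Algorithm n k) (r : ℕ → Fin n)
    (t₀ m : ℕ) : ℝ :=
  ∫ ω, cost r (A.run r ω) t₀ m ∂A.μ

/-- A family of algorithms, one for every time horizon `T` (known in advance), has competitive
ratio `α`: up to an additive constant independent of `T`, the expected cost is at most `α` times
that of every offline sequence of caches. -/
def HasCompetitiveRatio {n k : ℕ} (A : ℕ → Algorithm n k) (α : ℝ) : Prop :=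
  ∃ β : ℝ, 0 < β ∧ ∀ (T : ℕ) (r : ℕ → Fin n) (S : ℕ → Cache n k),
    (A T).expectedCost r 0 T ≤ α * cost r S 0 T + β

/-- The algorithm has regret at most `R` on the interval `{t₀ + 1, …, t₀ + m}`: for every request
sequence, it is compared to the best fixed cache on that interval. -/
def Algorithm.HasRegretBound {n k : ℕ} (A : Algorithm n k) (t₀ m : ℕ) (R : ℝ) : Prop :=
  ∀ (r : ℕ → Fin n) (C : Cache n k),
    A.expectedCost r t₀ m ≤ ∑ t ∈ Finset.Icc (t₀ + 1) (t₀ + m), missLoss (r t) C + R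

end Paging

/-!
Every move is charged to the step it leaves, so that costs add up over adjacent intervals. The
marking algorithm has competitive ratio `2 * H_k`, and multiplicative weights over the caches,
restarted on each block of length `2 ^ j`, compete on every such block with the best fixed cache.

Two algorithms are combined by a Prod-type rule in which the default has constant weight `1` and
the newcomer starts each block with the tiny weight `T⁻⁴`. As only `log T` enters the newcomer's
regret, the combination loses `O(k √(2 ^ j log T))` to the newcomer on each block, but only
`O(k / T ^ 2)` to the default on any interval starting at a block boundary. Hence, starting from
the marking algorithm, the experts of all scales can be added one after the other, from the coarsest
scale to the finest: no addition spoils the competitive ratio or the regret on coarser blocks, as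
these start at boundaries of the finer ones.

Finally, an arbitrary interval splits into dyadic blocks whose lengths first grow and then shrink
geometrically, so that the square roots of the lengths sum up to `O(√m)`.
-/

namespace Paging

section Coupling

variable {μ : Measure ℝ} [NullSingletonClass μ]

lemma continuous_measureReal_Iic [IsFiniteMeasure μ] : Continuous fun b => μ.real (Set.Iic b) := by
  have integrableOn_one (b : ℝ) : IntegrableOn (fun _ => (1 : ℝ)) (Set.Iic b) μ :=
    integrable_const 1
  have measureReal_eq (b : ℝ) :
      μ.real (Set.Iic b) = (∫ _ in 0..b, (1 : ℝ) ∂μ) + μ.real (Set.Iic 0) := by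
    rw [← intervalIntegral.integral_Iic_sub_Iic (integrableOn_one 0) (integrableOn_one b)]
    simp
  rw [funext measureReal_eq]
  exact (intervalIntegral.continuous_primitive (fun _ _ => intervalIntegrable_const) 0).add
    continuous_const

lemma exists_measurableSet_measureReal_eq [IsFiniteMeasure μ] {x : ℝ} (hx₀ : 0 ≤ x)
    (hx₁ : x ≤ μ.real Set.univ) : ∃ s, MeasurableSet s ∧ μ.real s = x := by
  rcases hx₀.eq_or_lt with rfl | hx₀
  · exact ⟨∅, .empty, measureReal_empty⟩
  rcases hx₁.eq_or_lt with rfl | hx₁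
  · exact ⟨Set.univ, .univ, rfl⟩
  have tendsto_atBot : Filter.Tendsto (fun b => μ.real (Set.Iic b)) .atBot (nhds 0) := by
    have := tendsto_measure_iInter_atBot (μ := μ) (s := fun b : ℝ => Set.Iic b)
      (fun _ => measurableSet_Iic.nullMeasurableSet) monotone_Iic ⟨0, measure_ne_top _ _⟩
    rw [iInter_Iic_eq_empty_iff.2 (by simp), measure_empty] at this
    exact (ENNReal.tendsto_toReal ENNReal.zero_ne_top).comp this
  have tendsto_atTop :
      Filter.Tendsto (fun b => μ.real (Set.Iic b)) .atTop (nhds (μ.real Set.univ)) :=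
    (ENNReal.tendsto_toReal (measure_ne_top _ _)).comp (tendsto_measure_Iic_atTop μ)
  obtain ⟨b, hb⟩ := mem_range_of_exists_le_of_exists_ge continuous_measureReal_Iic
    ((tendsto_atBot.eventually_lt_const hx₀).exists.imp fun _ => le_of_lt)
    ((tendsto_atTop.eventually_const_lt hx₁).exists.imp fun _ => le_of_lt)
  exact ⟨Set.Iic b, measurableSet_Iic, hb⟩

variable {ι : Type*} [MeasurableSpace ι]

lemma exists_measurable_measureReal_preimage_eq [IsFiniteMeasure μ] {s : Finset ι}
    (hs : s.Nonempty) {x : ι → ℝ} (hx : ∀ i, 0 ≤ x i) (hsum : ∑ i ∈ s, x i = μ.real Set.univ) :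
    ∃ g : ℝ → ι, Measurable g ∧ (∀ u, g u ∈ s) ∧ ∀ i ∈ s, μ.real (g ⁻¹' {i}) = x i := by
  classical
  induction hs using Finset.Nonempty.cons_induction generalizing μ with
  | singleton a => exact ⟨fun _ => a, measurable_const, by simp, by simpa using hsum.symm⟩
  | cons a s ha _ ih =>
    rw [Finset.sum_cons] at hsum
    have hs₀ : 0 ≤ ∑ i ∈ s, x i := Finset.sum_nonneg fun i _ => hx i
    obtain ⟨B, hB, hBa⟩ := exists_measurableSet_measureReal_eq (μ := μ) (hx a) (by linarith)
    obtain ⟨g, hg, hgs, hgx⟩ := ih (μ := μ.restrict Bᶜ) (by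
      rw [measureReal_restrict_apply .univ, Set.univ_inter, measureReal_compl hB]; linarith)
    refine ⟨B.piecewise (fun _ => a) g, measurable_const.piecewise hB hg, fun u => ?_,
      (Finset.forall_mem_cons ha _).2 ⟨?_, fun i hi => ?_⟩⟩
    · by_cases hu : u ∈ B <;> simp [hu, hgs]
    · have : g ⁻¹' {a} = ∅ := by
        ext u; simpa using fun hu : g u = a => ha (hu ▸ hgs u)
      simp [Set.piecewise_preimage, Set.ite, this, hBa]
    · have hai : a ≠ i := fun h => ha (h ▸ hi)
      rw [← hgx i hi, measureReal_restrict_apply' hB.compl]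
      simp [Set.piecewise_preimage, Set.ite, hai, Set.sdiff_eq]

lemma sum_measureReal_preimage_inter [Fintype ι] [MeasurableSingletonClass ι] {Ω : Type*}
    [MeasurableSpace Ω] {P : Measure Ω} [IsFiniteMeasure P] {f : Ω → ι} (hf : Measurable f)
    (s : Set Ω) : ∑ i, P.real (f ⁻¹' {i} ∩ s) = P.real s := by
  have := sum_measureReal_preimage_singleton (μ := P.restrict s) Finset.univ
    fun i _ => hf (.singleton i)
  simpa [measureReal_restrict_apply, hf (.singleton _)] using this

lemma exists_measurableSet_measureReal_preimage_inter_eq [IsFiniteMeasure μ] [Countable ι]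
    [MeasurableSingletonClass ι] {f : ℝ → ι} (hf : Measurable f) {x : ι → ℝ} (hx₀ : ∀ i, 0 ≤ x i)
    (hx : ∀ i, x i ≤ μ.real (f ⁻¹' {i})) :
    ∃ s, MeasurableSet s ∧ ∀ i, μ.real (f ⁻¹' {i} ∩ s) = x i := by
  have exists_part (i : ι) : ∃ s, MeasurableSet s ∧ (μ.restrict (f ⁻¹' {i})).real s = x i :=
    exists_measurableSet_measureReal_eq (hx₀ i) (by simpa using hx i)
  choose s hs hsx using exists_part
  refine ⟨⋃ i, s i ∩ f ⁻¹' {i}, .iUnion fun i => (hs i).inter (hf (.singleton i)), fun i => ?_⟩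
  have : f ⁻¹' {i} ∩ ⋃ j, s j ∩ f ⁻¹' {j} = s i ∩ f ⁻¹' {i} := by
    ext u; simp +contextual [and_comm]
  rw [this, ← measureReal_restrict_apply (hs i), hsx]

/-- Both variables equal `i` on a set of measure `min (p i) (q i)`, where `p` is the law of `f`;
the rest of the space is then divided so as to fill up the deficits `q i - min (p i) (q i)`. -/
lemma exists_maximal_coupling [IsProbabilityMeasure μ] [Fintype ι] [Nonempty ι]
    [MeasurableSingletonClass ι] {f : ℝ → ι} (hf : Measurable f) {q : ι → ℝ}
    (hq : q ∈ stdSimplex ℝ ι) :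
    ∃ g : ℝ → ι, Measurable g ∧ (∀ i, μ.real (g ⁻¹' {i}) = q i) ∧
      μ.real {u | f u ≠ g u} ≤ ∑ i, max (μ.real (f ⁻¹' {i}) - q i) 0 := by
  classical
  set p : ι → ℝ := fun i => μ.real (f ⁻¹' {i})
  obtain ⟨kept, hkept, kept_inter⟩ := exists_measurableSet_measureReal_preimage_inter_eq
    (x := fun i => min (p i) (q i)) hf (fun i => le_min measureReal_nonneg (hq.1 i))
    (fun i => min_le_left _ _)
  have measureReal_moved : μ.real keptᶜ = 1 - ∑ i, min (p i) (q i) := by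
    rw [probReal_compl_eq_one_sub hkept, ← sum_measureReal_preimage_inter hf]
    simp only [kept_inter]
  obtain ⟨h, hhm, -, hhq⟩ := exists_measurable_measureReal_preimage_eq (μ := μ.restrict keptᶜ)
    Finset.univ_nonempty (x := fun i => q i - min (p i) (q i))
    (fun i => sub_nonneg.2 (min_le_right _ _))
    (by simp only [Finset.sum_sub_distrib, hq.2, measureReal_restrict_apply_univ,
      measureReal_moved])
  refine ⟨kept.piecewise f h, hf.piecewise hkept hhm, fun i => ?_, ?_⟩
  · rw [Set.piecewise_preimage, Set.ite, measureReal_union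
      (Set.disjoint_sdiff_right.mono_left Set.inter_subset_right)
      ((hhm (.singleton i)).diff hkept), kept_inter, Set.sdiff_eq,
      ← measureReal_restrict_apply (hhm (.singleton i)), hhq i (Finset.mem_univ i)]
    ring
  · calc μ.real {u | f u ≠ kept.piecewise f h u} ≤ μ.real keptᶜ :=
          measureReal_mono fun u hu huk => hu (Set.piecewise_eq_of_mem _ _ _ huk).symm
      _ = ∑ i, (p i - min (p i) (q i)) := by
          have := sum_measureReal_preimage_inter (P := μ) hf Set.univ
          simp only [Set.inter_univ, probReal_univ] at this
          rw [Finset.sum_sub_distrib, this, measureReal_moved]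
      _ = ∑ i, max (p i - q i) 0 := by
          simp only [← max_sub_sub_left, sub_self, max_comm]

end Coupling

section CoupledPath

variable {μ : Measure ℝ} {ι : Type*} [MeasurableSpace ι] [Fintype ι] [Nonempty ι]

/-- A random variable with law `q` that differs from `f` as rarely as possible; it is only
meaningful where `exists_maximal_coupling` applies. -/
noncomputable def recouple (μ : Measure ℝ) (f : ℝ → ι) (q : ι → ℝ) : ℝ → ι :=
  Classical.epsilon fun g => Measurable g ∧ (∀ i, μ.real (g ⁻¹' {i}) = q i) ∧
    μ.real {u | f u ≠ g u} ≤ ∑ i, max (μ.real (f ⁻¹' {i}) - q i) 0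

/-- The process with one-dimensional laws `p 0, p 1, …` obtained by successive maximal
couplings. -/
noncomputable def coupledPath (μ : Measure ℝ) (p : ℕ → ι → ℝ) : ℕ → ℝ → ι
  | 0 => recouple μ (fun _ => Classical.arbitrary ι) (p 0)
  | t + 1 => recouple μ (coupledPath μ p t) (p (t + 1))

lemma coupledPath_congr {p p' : ℕ → ι → ℝ} {t : ℕ} (h : ∀ s ≤ t, p s = p' s) :
    coupledPath μ p t = coupledPath μ p' t := by
  induction t with
  | zero => simp only [coupledPath, h 0 le_rfl]
  | succ t ih =>
    simp only [coupledPath, h (t + 1) le_rfl, ih fun s hs => h s (hs.trans t.le_succ)]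

variable [NullSingletonClass μ] [IsProbabilityMeasure μ] [MeasurableSingletonClass ι]

lemma recouple_spec {f : ℝ → ι} (hf : Measurable f) {q : ι → ℝ} (hq : q ∈ stdSimplex ℝ ι) :
    Measurable (recouple μ f q) ∧ (∀ i, μ.real (recouple μ f q ⁻¹' {i}) = q i) ∧
      μ.real {u | f u ≠ recouple μ f q u} ≤ ∑ i, max (μ.real (f ⁻¹' {i}) - q i) 0 :=
  Classical.epsilon_spec (exists_maximal_coupling hf hq)

variable {p : ℕ → ι → ℝ} (hp : ∀ t, p t ∈ stdSimplex ℝ ι) (t : ℕ)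
include hp

lemma measurable_coupledPath : Measurable (coupledPath μ p t) := by
  induction t with
  | zero => exact (recouple_spec measurable_const (hp 0)).1
  | succ t ih => exact (recouple_spec ih (hp (t + 1))).1

lemma measureReal_coupledPath_preimage (i : ι) :
    μ.real (coupledPath μ p t ⁻¹' {i}) = p t i := by
  cases t with
  | zero => exact (recouple_spec measurable_const (hp 0)).2.1 i
  | succ t => exact (recouple_spec (measurable_coupledPath hp t) (hp (t + 1))).2.1 i

lemma measureReal_coupledPath_ne_le :
    μ.real {u | coupledPath μ p t u ≠ coupledPath μ p (t + 1) u} ≤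
      ∑ i, max (p t i - p (t + 1) i) 0 := by
  have measurable_path : Measurable (coupledPath μ p t) := measurable_coupledPath hp t
  have := (recouple_spec (μ := μ) measurable_path (hp (t + 1))).2.2
  simp only [measureReal_coupledPath_preimage hp t] at this
  exact this

end CoupledPath

lemma integral_comp_eq_sum {Ω ι : Type*} [MeasurableSpace Ω] {P : Measure Ω} [IsFiniteMeasure P]
    [MeasurableSpace ι] [MeasurableSingletonClass ι] [Fintype ι] {X : Ω → ι} (hX : Measurable X)
    (f : ι → ℝ) : ∫ ω, f (X ω) ∂P = ∑ i, P.real (X ⁻¹' {i}) * f i := by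
  rw [← integral_map hX.aemeasurable (measurable_of_finite f).aestronglyMeasurable,
    integral_fintype .of_finite]
  simp only [map_measureReal_apply hX (.singleton _), smul_eq_mul]

/-- The uniform distribution on `[0, 1]`. -/
noncomputable def uniform01 : Measure ℝ := volume.restrict (Set.Icc 0 1)

instance : IsProbabilityMeasure uniform01 := ⟨by simp [uniform01]⟩

instance : NullSingletonClass uniform01 := by unfold uniform01; infer_instance

lemma uniform01_real_Iio {p : ℝ} (hp₀ : 0 ≤ p) (hp₁ : p ≤ 1) :
    uniform01.real (Set.Iio p) = p := by
  have : Set.Iio p ∩ Set.Icc 0 1 = Set.Ico 0 p := by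
    ext x
    simp only [Set.mem_inter_iff, Set.mem_Iio, Set.mem_Icc, Set.mem_Ico]
    grind
  simp [uniform01, measureReal_restrict_apply measurableSet_Iio, this, hp₀]

variable {n k : ℕ}

lemma moveCost_nonneg (C C' : Cache n k) : 0 ≤ moveCost C C' := Nat.cast_nonneg _

lemma moveCost_le (C C' : Cache n k) : moveCost C C' ≤ k :=
  Nat.cast_le.2 ((Finset.card_le_card Finset.sdiff_subset).trans C.2.le)

lemma moveCost_self (C : Cache n k) : moveCost C C = 0 := by simp [moveCost]

lemma missLoss_nonneg (i : Fin n) (C : Cache n k) : 0 ≤ missLoss i C := by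
  unfold missLoss; split_ifs <;> norm_num

lemma missLoss_le (i : Fin n) (C : Cache n k) : missLoss i C ≤ 2 := by
  unfold missLoss; split_ifs <;> norm_num

/-- The cost of being in cache `C` when page `i` is requested and of moving on to `C'`. Charging
each move together with the step it leaves makes the costs of adjacent intervals add up. -/
def transitionCost (i : Fin n) (C C' : Cache n k) : ℝ := missLoss i C + moveCost C' C

lemma transitionCost_nonneg (i : Fin n) (C C' : Cache n k) : 0 ≤ transitionCost i C C' :=
  add_nonneg (missLoss_nonneg i C) (moveCost_nonneg C' C)

lemma transitionCost_le (i : Fin n) (C C' : Cache n k) : transitionCost i C C' ≤ 2 + k :=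
  add_le_add (missLoss_le i C) (moveCost_le C' C)

lemma cost_succ_eq (r : ℕ → Fin n) (S : ℕ → Cache n k) (t₀ m : ℕ) :
    cost r S t₀ (m + 1) = ∑ t ∈ Finset.Ioc t₀ (t₀ + m), transitionCost (r t) (S t) (S (t + 1)) +
      missLoss (r (t₀ + m + 1)) (S (t₀ + m + 1)) := by
  have Icc_moves : Finset.Icc (t₀ + 2) (t₀ + (m + 1)) =
      (Finset.Ioc t₀ (t₀ + m)).map (addRightEmbedding 1) := by
    rw [Finset.map_add_right_Ioc]; ext; simp only [Finset.mem_Icc, Finset.mem_Ioc]; omega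
  have Icc_serves : Finset.Icc (t₀ + 1) (t₀ + (m + 1)) = Finset.Ioc t₀ (t₀ + m + 1) := by
    ext; simp only [Finset.mem_Icc, Finset.mem_Ioc]; omega
  rw [cost, Icc_moves, Icc_serves, Finset.sum_map, Finset.sum_Ioc_succ_top (by omega)]
  simp only [transitionCost, Finset.sum_add_distrib, addRightEmbedding_apply, Nat.add_sub_cancel]
  ring

lemma cost_le_sum_transitionCost (r : ℕ → Fin n) (S : ℕ → Cache n k) (t₀ m : ℕ) :
    cost r S t₀ m ≤ ∑ t ∈ Finset.Ioc t₀ (t₀ + m), transitionCost (r t) (S t) (S (t + 1)) := by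
  cases m with
  | zero => simp [cost]
  | succ m =>
    rw [cost_succ_eq, ← add_assoc, Finset.sum_Ioc_succ_top (by omega), transitionCost]
    linarith [moveCost_nonneg (S (t₀ + m + 1 + 1)) (S (t₀ + m + 1))]

section Nonanticipating

variable {α : Type*}

lemma length_history (r : ℕ → Fin n) (t : ℕ) : (history r t).length = t := by simp [history]

lemma history_eq_history_iff {r r' : ℕ → Fin n} {t : ℕ} :
    history r t = history r' t ↔ ∀ s, 1 ≤ s → s ≤ t → r s = r' s := by
  simp only [history, List.map_inj_left, List.mem_range]
  constructor
  · intro h s hs hst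
    obtain ⟨s, rfl⟩ := Nat.exists_eq_add_of_le' hs
    exact h s hst
  · exact fun h s hs => h (s + 1) s.succ_pos hs

/-- A quantity that, at time `t`, depends only on the requests revealed up to time `t`. -/
def Nonanticipating (F : (ℕ → Fin n) → ℕ → α) : Prop :=
  ∀ ⦃r r' : ℕ → Fin n⦄ ⦃t : ℕ⦄, (∀ s, 1 ≤ s → s ≤ t → r s = r' s) → F r t = F r' t

/-- A nonanticipating quantity as a function of the list of revealed requests, with value `a` on
lists that are not the history of a request sequence. -/
noncomputable def onHistory (a : α) (F : (ℕ → Fin n) → ℕ → α) : List (Fin n) → α :=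
  Function.extend (fun q : (ℕ → Fin n) × ℕ => history q.1 q.2) (fun q => F q.1 q.2) fun _ => a

lemma Nonanticipating.onHistory_history {F : (ℕ → Fin n) → ℕ → α} (hF : Nonanticipating F) (a : α)
    (r : ℕ → Fin n) (t : ℕ) : onHistory a F (history r t) = F r t := by
  refine Function.FactorsThrough.extend_apply (f := fun q : (ℕ → Fin n) × ℕ => history q.1 q.2)
    (g := fun q => F q.1 q.2) ?_ _ (r, t)
  rintro ⟨r, t⟩ ⟨r', t'⟩ h
  obtain rfl : t = t' := by simpa only [length_history] using congrArg List.length h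
  exact hF (history_eq_history_iff.1 h)

lemma onHistory_induction {P : α → Prop} {a : α} {F : (ℕ → Fin n) → ℕ → α} (ha : P a)
    (hF : ∀ r t, P (F r t)) (h : List (Fin n)) : P (onHistory a F h) := by
  classical
  rw [onHistory, Function.extend_def]
  split_ifs
  · exact hF _ _
  · exact ha

end Nonanticipating

namespace Algorithm

/-- Caches form a finite set, hence a discrete measurable space. -/
instance : MeasurableSpace (Cache n k) := ⊤

instance : DiscreteMeasurableSpace (Cache n k) := ⟨fun _ => trivial⟩

lemma measurable_run (A : Algorithm n k) (r : ℕ → Fin n) (t : ℕ) :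
    Measurable fun ω => A.run r ω t :=
  measurable_to_countable' (A.measurable_act _)

lemma integrable_run (A : Algorithm n k) (f : Cache n k → Cache n k → ℝ) (r : ℕ → Fin n)
    (t t' : ℕ) : Integrable (fun ω => f (A.run r ω t) (A.run r ω t')) A.μ := by
  have := Integrable.of_finite (f := fun q : Cache n k × Cache n k => f q.1 q.2)
    (μ := A.μ.map fun ω => (A.run r ω t, A.run r ω t'))
  exact this.comp_measurable ((A.measurable_run r t).prodMk (A.measurable_run r t'))

/-- The expected cost of serving the request at time `t` and of the next move. -/
noncomputable def stepCost (A : Algorithm n k) (r : ℕ → Fin n) (t : ℕ) : ℝ :=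
  ∫ ω, transitionCost (r t) (A.run r ω t) (A.run r ω (t + 1)) ∂A.μ

lemma integrable_transitionCost (A : Algorithm n k) (r : ℕ → Fin n) (t : ℕ) :
    Integrable (fun ω => transitionCost (r t) (A.run r ω t) (A.run r ω (t + 1))) A.μ :=
  A.integrable_run (transitionCost (r t)) r t (t + 1)

lemma stepCost_nonneg (A : Algorithm n k) (r : ℕ → Fin n) (t : ℕ) : 0 ≤ A.stepCost r t :=
  integral_nonneg fun _ => transitionCost_nonneg _ _ _

lemma stepCost_le (A : Algorithm n k) (r : ℕ → Fin n) (t : ℕ) : A.stepCost r t ≤ 2 + k := by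
  have := integral_mono (A.integrable_transitionCost r t) (integrable_const (2 + k : ℝ))
    fun ω => transitionCost_le _ _ _
  simpa [stepCost] using this

lemma stepCost_congr (A : Algorithm n k) {r r' : ℕ → Fin n} {t : ℕ} (ht : 1 ≤ t)
    (h : ∀ s, 1 ≤ s → s ≤ t + 1 → r s = r' s) : A.stepCost r t = A.stepCost r' t := by
  have h' : ∀ s, 1 ≤ s → s ≤ t → r s = r' s := fun s hs hst => h s hs (hst.trans t.le_succ)
  simp only [stepCost, run, history_eq_history_iff.2 h, history_eq_history_iff.2 h',
    h' t ht le_rfl]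

lemma expectedCost_le_sum_stepCost (A : Algorithm n k) (r : ℕ → Fin n) (t₀ m : ℕ) :
    A.expectedCost r t₀ m ≤ ∑ t ∈ Finset.Ioc t₀ (t₀ + m), A.stepCost r t := by
  unfold expectedCost stepCost
  rw [← integral_finsetSum _ fun t _ => A.integrable_transitionCost r t]
  refine integral_mono ?_ (integrable_finsetSum _ fun t _ => A.integrable_transitionCost r t)
    fun ω => cost_le_sum_transitionCost r _ t₀ m
  exact (integrable_finsetSum _ fun t _ => A.integrable_run (fun C _ => missLoss (r t) C) r t t).add
    (integrable_finsetSum _ fun t _ => A.integrable_run moveCost r t (t - 1))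

end Algorithm

/-- Follow `B` if a uniformly random threshold is below `p`, and `A` otherwise. -/
noncomputable def mix (A B : Algorithm n k) (p : (ℕ → Fin n) → ℕ → ℝ) : Algorithm n k where
  Ω := (A.Ω × B.Ω) × ℝ
  μ := (A.μ.prod B.μ).prod uniform01
  act h ω := if ω.2 < onHistory 0 p h then B.act h ω.1.2 else A.act h ω.1.1
  measurable_act h C := by
    have measurable_choice : Measurable fun ω : (A.Ω × B.Ω) × ℝ =>
        if ω.2 < onHistory 0 p h then B.act h ω.1.2 else A.act h ω.1.1 :=
      .ite (measurableSet_lt measurable_snd measurable_const)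
        ((measurable_to_countable' (B.measurable_act h)).comp (by fun_prop))
        ((measurable_to_countable' (A.measurable_act h)).comp (by fun_prop))
    exact measurable_choice (.singleton C)

lemma mix_run {A B : Algorithm n k} {p : (ℕ → Fin n) → ℕ → ℝ} (hp : Nonanticipating p)
    (r : ℕ → Fin n) (x : A.Ω) (y : B.Ω) (u : ℝ) (t : ℕ) :
    (mix A B p).run r ((x, y), u) t = if u < p r t then B.run r y t else A.run r x t := by
  simp only [Algorithm.run, mix, hp.onHistory_history]

/-- Besides the costs of the two algorithms, the mixture pays at most `k` whenever the threshold
lies between the two probabilities. -/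
lemma transitionCost_ite_le (i : Fin n) (C C' D D' : Cache n k) (a b u : ℝ) :
    transitionCost i (if u < a then D else C) (if u < b then D' else C') ≤
      (Set.Iio a)ᶜ.indicator (fun _ => transitionCost i C C') u +
        (Set.Iio a).indicator (fun _ => transitionCost i D D') u +
        (Set.Iio (max a b) \ Set.Iio (min a b)).indicator (fun _ => (k : ℝ)) u := by
  have := moveCost_le C' D
  have := moveCost_le D' C
  have := moveCost_nonneg C' C
  have := moveCost_nonneg D' D
  simp only [transitionCost, Set.indicator, Set.mem_compl_iff, Set.mem_sdiff, Set.mem_Iio,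
    lt_max_iff, lt_min_iff]
  split_ifs <;> grind

lemma integral_transitionCost_ite_le (i : Fin n) (C C' D D' : Cache n k) {a b : ℝ} (ha₀ : 0 ≤ a)
    (ha₁ : a ≤ 1) (hb₀ : 0 ≤ b) (hb₁ : b ≤ 1) :
    ∫ u, transitionCost i (if u < a then D else C) (if u < b then D' else C') ∂uniform01 ≤
      (1 - a) * transitionCost i C C' + a * transitionCost i D D' + |b - a| * k := by
  have measurableSet_between : MeasurableSet (Set.Iio (max a b) \ Set.Iio (min a b)) :=
    measurableSet_Iio.diff measurableSet_Iio
  have integrable_indicator (c : ℝ) {s : Set ℝ} (hs : MeasurableSet s) :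
      Integrable (s.indicator fun _ => c) uniform01 := (integrable_const c).indicator hs
  have integrable_stay := (integrable_indicator (transitionCost i C C')
    (measurableSet_Iio (a := a)).compl).fun_add
      (integrable_indicator (transitionCost i D D') (measurableSet_Iio (a := a)))
  have integrable_switch := integrable_indicator k measurableSet_between
  refine (integral_mono_of_nonneg (.of_forall fun _ => transitionCost_nonneg _ _ _)
    (integrable_stay.fun_add integrable_switch)
    (.of_forall fun u => transitionCost_ite_le i C C' D D' a b u)).trans_eq ?_
  rw [integral_add integrable_stay integrable_switch,
    integral_add (integrable_indicator _ measurableSet_Iio.compl)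
      (integrable_indicator _ measurableSet_Iio),
    integral_indicator_const _ measurableSet_Iio.compl,
    integral_indicator_const _ measurableSet_Iio,
    integral_indicator_const _ measurableSet_between, probReal_compl_eq_one_sub measurableSet_Iio,
    measureReal_sdiff (Set.Iio_subset_Iio min_le_max) measurableSet_Iio,
    uniform01_real_Iio ha₀ ha₁, uniform01_real_Iio (le_max_of_le_left ha₀) (max_le ha₁ hb₁),
    uniform01_real_Iio (le_min ha₀ hb₀) (min_le_of_left_le ha₁), max_sub_min_eq_abs]
  simp only [smul_eq_mul]

lemma stepCost_mix_le (A B : Algorithm n k) {p : (ℕ → Fin n) → ℕ → ℝ} (hp : Nonanticipating p)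
    (hp₀ : ∀ r t, 0 ≤ p r t) (hp₁ : ∀ r t, p r t ≤ 1) (r : ℕ → Fin n) (t : ℕ) :
    (mix A B p).stepCost r t ≤ (1 - p r t) * A.stepCost r t + p r t * B.stepCost r t +
      |p r (t + 1) - p r t| * k := by
  set a := p r t
  set b := p r (t + 1)
  let costA (x : A.Ω) : ℝ := transitionCost (r t) (A.run r x t) (A.run r x (t + 1))
  let costB (y : B.Ω) : ℝ := transitionCost (r t) (B.run r y t) (B.run r y (t + 1))
  have integrable_costA : Integrable (fun z : A.Ω × B.Ω => (1 - a) * costA z.1) (A.μ.prod B.μ) :=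
    ((A.integrable_transitionCost r t).comp_fst B.μ).const_mul _
  have integrable_costB : Integrable (fun z : A.Ω × B.Ω => a * costB z.2) (A.μ.prod B.μ) :=
    ((B.integrable_transitionCost r t).comp_snd A.μ).const_mul _
  have integrable_mix := (mix A B p).integrable_transitionCost r t
  calc (mix A B p).stepCost r t
      = ∫ z, ∫ u, transitionCost (r t) ((mix A B p).run r (z, u) t)
          ((mix A B p).run r (z, u) (t + 1)) ∂uniform01 ∂(A.μ.prod B.μ) :=
        integral_prod _ integrable_mix
    _ ≤ ∫ z, ((1 - a) * costA z.1 + a * costB z.2 + |b - a| * k) ∂(A.μ.prod B.μ) := by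
        refine integral_mono integrable_mix.integral_prod_left
          ((integrable_costA.add integrable_costB).add (integrable_const _)) fun z => ?_
        simp only [mix_run hp]
        exact integral_transitionCost_ite_le _ _ _ _ _ (hp₀ r t) (hp₁ r t) (hp₀ r (t + 1))
          (hp₁ r (t + 1))
    _ = (1 - a) * A.stepCost r t + a * B.stepCost r t + |b - a| * k := by
        rw [integral_add (integrable_costA.fun_add integrable_costB) (integrable_const _),
          integral_add integrable_costA integrable_costB, integral_const_mul, integral_const_mul,
          integral_fun_fst costA, integral_fun_snd costB]
        simp [Algorithm.stepCost, costA, costB]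

lemma transitionCost_le_add_indicator (i : Fin n) (C C' : Cache n k) :
    transitionCost i C C' ≤ missLoss i C + if C = C' then 0 else (k : ℝ) := by
  refine add_le_add_right ?_ _
  split_ifs with h
  · rw [h, moveCost_self]
  · exact moveCost_le C' C

lemma exists_algorithm_of_laws [Nonempty (Cache n k)] {p : (ℕ → Fin n) → ℕ → Cache n k → ℝ}
    (hp : Nonanticipating p) (hps : ∀ r t, p r t ∈ stdSimplex ℝ (Cache n k)) :
    ∃ A : Algorithm n k, ∀ r t,
      A.stepCost r t ≤ ∑ C, p r t C * missLoss (r t) C +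
        k * ∑ C, max (p r t C - p r (t + 1) C) 0 := by
  set path : (ℕ → Fin n) → ℕ → ℝ → Cache n k := fun r => coupledPath uniform01 (p r)
  have path_nonanticipating : Nonanticipating path := fun r r' t h =>
    coupledPath_congr fun s hs => hp fun u hu hus => h u hu (hus.trans hs)
  have measurable_path (r t) : Measurable (path r t) := measurable_coupledPath (hps r) t
  let A : Algorithm n k :=
    { Ω := ℝ
      μ := uniform01
      act := onHistory (fun _ => Classical.arbitrary _) path
      measurable_act := fun h C => onHistory_induction (P := Measurable) measurable_const
        measurable_path h (.singleton C) }
  have A_run (r t u) : A.run r u t = path r t u :=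
    congrFun (path_nonanticipating.onHistory_history _ r t) u
  refine ⟨A, fun r t => ?_⟩
  have measurableSet_moves : MeasurableSet {u | path r t u ≠ path r (t + 1) u} :=
    (measurableSet_eq_fun (measurable_path r t) (measurable_path r (t + 1))).compl
  have integrable_miss : Integrable (fun u => missLoss (r t) (path r t u)) uniform01 := by
    simpa only [A_run] using A.integrable_run (fun C _ => missLoss (r t) C) r t t
  have integrable_moves : Integrable ({u | path r t u ≠ path r (t + 1) u}.indicator
    fun _ => (k : ℝ)) uniform01 := (integrable_const _).indicator measurableSet_moves
  calc A.stepCost r t ≤ ∫ u, (missLoss (r t) (path r t u) +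
        {u | path r t u ≠ path r (t + 1) u}.indicator (fun _ => (k : ℝ)) u) ∂uniform01 := by
        refine integral_mono (A.integrable_transitionCost r t)
          (integrable_miss.add integrable_moves) fun u => ?_
        simpa [A_run, Set.indicator] using transitionCost_le_add_indicator _ _ _
    _ = ∑ C, p r t C * missLoss (r t) C +
        uniform01.real {u | path r t u ≠ path r (t + 1) u} * k := by
        rw [integral_add integrable_miss integrable_moves,
          integral_comp_eq_sum (measurable_path r t),
          integral_indicator_const _ measurableSet_moves]
        simp only [path, measureReal_coupledPath_preimage (hps r), smul_eq_mul]
    _ ≤ _ := by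
        rw [mul_comm]
        gcongr
        exact measureReal_coupledPath_ne_le (hps r) t

lemma sub_sq_le_log_one_add {x : ℝ} (hx : |x| ≤ 1 / 2) : x - x ^ 2 ≤ Real.log (1 + x) := by
  obtain ⟨hx₀, hx₁⟩ := abs_le.1 hx
  have one_add_pos : 0 < 1 + x := by linarith
  rcases le_total 0 x with h | h
  · refine le_trans ?_ (Real.one_sub_inv_le_log_of_pos one_add_pos)
    rw [le_sub_comm, inv_le_iff_one_le_mul₀ one_add_pos]
    nlinarith [pow_nonneg h 3]
  · have quadratic_le_exp := Real.quadratic_le_exp_of_nonneg (x := x ^ 2 - x) (by nlinarith)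
    rw [Real.le_log_iff_exp_le one_add_pos, ← neg_sub, Real.exp_neg,
      inv_le_iff_one_le_mul₀ (Real.exp_pos _)]
    refine le_trans ?_ (mul_le_mul_of_nonneg_left quadratic_le_exp one_add_pos.le)
    nlinarith [mul_nonneg (sq_nonneg x) (show 0 ≤ 1 + x - x ^ 2 + x ^ 3 by nlinarith [sq_nonneg x])]

lemma neg_mul_sum_le_log_prod_one_sub {α : Type*} (s : Finset α) {x : α → ℝ} {b : ℝ}
    (hx₀ : ∀ a, 0 ≤ x a) (hxb : ∀ a, x a ≤ b) (hb : b ≤ 1 / 2) :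
    -((1 + b) * ∑ a ∈ s, x a) ≤ Real.log (∏ a ∈ s, (1 - x a)) := by
  have factor_pos (a) : 0 < 1 - x a := by linarith [hxb a]
  rw [Real.log_prod fun a _ => (factor_pos a).ne', Finset.mul_sum, ← Finset.sum_neg_distrib]
  refine Finset.sum_le_sum fun a _ => ?_
  have := sub_sq_le_log_one_add (x := -x a) ((abs_neg (x a)).trans_le
    ((abs_of_nonneg (hx₀ a)).trans_le ((hxb a).trans hb)))
  rw [← sub_eq_add_neg] at this
  nlinarith [mul_le_mul_of_nonneg_left (hxb a) (hx₀ a)]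

section RestartProd

variable {M : Type*}

/-- The product of the factors `g t` since the last restart. The product is reset to `w₀` after
each multiple of `τ`, so that it runs over the blocks `{s * τ + 1, …, s * τ + τ}`. -/
def restartProd [Mul M] (τ : ℕ) (w₀ : M) (g : ℕ → M) : ℕ → M
  | 0 => w₀
  | t + 1 => if τ ∣ t then w₀ else restartProd τ w₀ g t * g t

lemma restartProd_congr [Mul M] {τ : ℕ} {w₀ : M} {g g' : ℕ → M} {t : ℕ}
    (h : ∀ s, 1 ≤ s → s < t → g s = g' s) : restartProd τ w₀ g t = restartProd τ w₀ g' t := by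
  induction t with
  | zero => rfl
  | succ t ih =>
    rcases t.eq_zero_or_pos with rfl | ht
    · simp [restartProd]
    · rw [restartProd, restartProd, ih fun s hs hst => h s hs (hst.trans t.lt_succ_self),
        h t ht t.lt_succ_self]

lemma restartProd_induction [Mul M] {P : M → Prop} {τ : ℕ} {w₀ : M} {g : ℕ → M} (h₀ : P w₀)
    (hmul : ∀ t w, P w → P (w * g t)) (t : ℕ) : P (restartProd τ w₀ g t) := by
  induction t with
  | zero => exact h₀
  | succ t ih =>
    rw [restartProd]
    split_ifs
    · exact h₀
    · exact hmul t _ ih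

lemma not_dvd_mul_add {τ m : ℕ} (s : ℕ) (hm₀ : 0 < m) (hm : m < τ) : ¬τ ∣ s * τ + m :=
  (Nat.dvd_add_right (dvd_mul_left τ s)).not.2 (Nat.not_dvd_of_pos_of_lt hm₀ hm)

lemma restartProd_eq_prod [CommMonoid M] {τ : ℕ} (w₀ : M) (g : ℕ → M) (s : ℕ) {m : ℕ}
    (hm : m < τ) :
    restartProd τ w₀ g (s * τ + m + 1) = w₀ * ∏ t ∈ Finset.Ioc (s * τ) (s * τ + m), g t := by
  induction m with
  | zero => simp [restartProd]
  | succ m ih =>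
    rw [restartProd, if_neg (not_dvd_mul_add s m.succ_pos hm), ← add_assoc,
      ih (m.lt_succ_self.trans hm), Finset.prod_Ioc_succ_top (by omega), mul_assoc]

lemma sum_restartProd_mul_sub [CommMonoid M] {A : Type*} [AddCommGroup A] (Φ : M → A) {τ : ℕ}
    (w₀ : M) (g : ℕ → M) (s : ℕ) {m : ℕ} (hm : m ≤ τ) :
    ∑ t ∈ Finset.Ioc (s * τ) (s * τ + m),
        (Φ (restartProd τ w₀ g t * g t) - Φ (restartProd τ w₀ g t)) =
      Φ (w₀ * ∏ t ∈ Finset.Ioc (s * τ) (s * τ + m), g t) - Φ w₀ := by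
  induction m with
  | zero => simp
  | succ m ih =>
    rw [← add_assoc, Finset.sum_Ioc_succ_top (by omega), Finset.prod_Ioc_succ_top (by omega),
      ih (m.le_succ.trans hm), restartProd_eq_prod w₀ g s hm, mul_assoc]
    abel

/-- Only the restart at the end of a block is not a multiplication. -/
lemma sum_restartProd_succ_le [Mul M] {D : M → M → ℝ} {τ : ℕ} {w₀ : M} {g : ℕ → M} {c : ℝ}
    (hD : ∀ t, 0 ≤ D (restartProd τ w₀ g t) (restartProd τ w₀ g t * g t)) (hc₀ : 0 ≤ c)
    (hc : ∀ t, D (restartProd τ w₀ g t) (restartProd τ w₀ g (t + 1)) ≤ c) (s : ℕ) :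
    ∑ t ∈ Finset.Ioc (s * τ) (s * τ + τ), D (restartProd τ w₀ g t) (restartProd τ w₀ g (t + 1)) ≤
      ∑ t ∈ Finset.Ioc (s * τ) (s * τ + τ), D (restartProd τ w₀ g t) (restartProd τ w₀ g t * g t) +
        c := by
  obtain rfl | ⟨m, rfl⟩ : τ = 0 ∨ ∃ m, τ = m + 1 := by cases τ <;> simp
  · simpa using hc₀
  · have inside_block : ∀ t ∈ Finset.Ioc (s * (m + 1)) (s * (m + 1) + m),
        restartProd (m + 1) w₀ g (t + 1) = restartProd (m + 1) w₀ g t * g t := by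
      intro t ht
      obtain ⟨ht₀, ht₁⟩ := Finset.mem_Ioc.1 ht
      obtain ⟨j, rfl⟩ := Nat.exists_eq_add_of_lt ht₀
      exact if_neg (not_dvd_mul_add s j.succ_pos (by omega))
    rw [← add_assoc, Finset.sum_Ioc_succ_top (by omega), Finset.sum_Ioc_succ_top (by omega),
      Finset.sum_congr rfl fun t ht => by rw [inside_block t ht]]
    linarith [hD (s * (m + 1) + m + 1), hc (s * (m + 1) + m + 1)]

end RestartProd

section MultiplicativeWeights

variable {ι : Type*} {τ : ℕ} {η b : ℝ} {ℓ : ℕ → ι → ℝ}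

/-- The multiplicative weights of experts with losses `ℓ t` at time `t`, for the learning rate `η`
and with a restart after every `τ` steps. -/
noncomputable def mwWeight (τ : ℕ) (η : ℝ) (ℓ : ℕ → ι → ℝ) : ℕ → ι → ℝ :=
  restartProd τ 1 fun t => 1 - η • ℓ t

lemma mul_one_sub_pos {w x : ι → ℝ} (hw : ∀ i, 0 < w i) (hx : ∀ i, x i < 1) (i : ι) :
    0 < (w * (1 - x)) i := mul_pos (hw i) (sub_pos.2 (hx i))

lemma mwWeight_pos (hx : ∀ t i, η * ℓ t i < 1) (t : ℕ) : ∀ i, 0 < mwWeight τ η ℓ t i :=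
  restartProd_induction (P := fun w : ι → ℝ => ∀ i, 0 < w i) (fun _ => one_pos)
    (fun t _ hw => mul_one_sub_pos hw (hx t)) t

variable [Fintype ι]

lemma sum_max_sub_le_one {p q : ι → ℝ} (hp : p ∈ stdSimplex ℝ ι) (hq : q ∈ stdSimplex ℝ ι) :
    ∑ i, max (p i - q i) 0 ≤ 1 :=
  hp.2 ▸ Finset.sum_le_sum fun i _ => max_le (sub_le_self _ (hq.1 i)) (hp.1 i)

/-- The probability distribution proportional to positive weights. -/
noncomputable def weightLaw (w : ι → ℝ) (i : ι) : ℝ := w i / ∑ j, w j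

/-- The distribution over the experts chosen by the multiplicative weights algorithm. -/
noncomputable def mwLaw (τ : ℕ) (η : ℝ) (ℓ : ℕ → ι → ℝ) (t : ℕ) : ι → ℝ :=
  weightLaw (mwWeight τ η ℓ t)

variable [Nonempty ι]

lemma sum_pos_of_pos {w : ι → ℝ} (hw : ∀ i, 0 < w i) : 0 < ∑ i, w i :=
  Finset.sum_pos (fun i _ => hw i) Finset.univ_nonempty

lemma weightLaw_mem_stdSimplex {w : ι → ℝ} (hw : ∀ i, 0 < w i) : weightLaw w ∈ stdSimplex ℝ ι := by
  refine ⟨fun i => div_nonneg (hw i).le (sum_pos_of_pos hw).le, ?_⟩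
  simp only [weightLaw]
  rw [← Finset.sum_div, div_self (sum_pos_of_pos hw).ne']

lemma log_sum_mul_one_sub_le {w x : ι → ℝ} (hw : ∀ i, 0 < w i) (hx : ∀ i, x i < 1) :
    Real.log (∑ i, (w * (1 - x)) i) ≤ Real.log (∑ i, w i) - ∑ i, weightLaw w i * x i := by
  have sum_w_pos := sum_pos_of_pos hw
  have sum_eq : ∑ i, (w * (1 - x)) i = (∑ i, w i) * (1 - ∑ i, weightLaw w i * x i) := by
    simp only [Pi.mul_apply, Pi.sub_apply, Pi.one_apply, mul_sub, mul_one, Finset.mul_sum,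
      Finset.sum_sub_distrib, weightLaw]
    field_simp
  have one_sub_mean_pos : 0 < 1 - ∑ i, weightLaw w i * x i := by
    refine pos_of_mul_pos_right (a := ∑ i, w i) ?_ sum_w_pos.le
    rw [← sum_eq]
    exact sum_pos_of_pos (mul_one_sub_pos hw hx)
  rw [sum_eq, Real.log_mul sum_w_pos.ne' one_sub_mean_pos.ne']
  linarith [Real.log_le_sub_one_of_pos one_sub_mean_pos]

lemma sum_max_weightLaw_sub_le {w x : ι → ℝ} (hw : ∀ i, 0 < w i) (hx₀ : ∀ i, 0 ≤ x i)
    (hx₁ : ∀ i, x i < 1) :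
    ∑ i, max (weightLaw w i - weightLaw (w * (1 - x)) i) 0 ≤ ∑ i, weightLaw w i * x i := by
  have total_antitone : ∑ i, (w * (1 - x)) i ≤ ∑ i, w i :=
    Finset.sum_le_sum fun i _ => mul_le_of_le_one_right (hw i).le (sub_le_self _ (hx₀ i))
  refine Finset.sum_le_sum fun i _ =>
    max_le ?_ (mul_nonneg ((weightLaw_mem_stdSimplex hw).1 i) (hx₀ i))
  have new_law_ge : (w * (1 - x)) i / ∑ i, w i ≤ weightLaw (w * (1 - x)) i :=
    div_le_div_of_nonneg_left (mul_one_sub_pos hw hx₁ i).le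
      (sum_pos_of_pos (mul_one_sub_pos hw hx₁)) total_antitone
  have : (w * (1 - x)) i / ∑ i, w i = weightLaw w i - weightLaw w i * x i := by
    simp only [weightLaw, Pi.mul_apply, Pi.sub_apply, Pi.one_apply]; ring
  linarith

lemma mwLaw_mem_stdSimplex (hx : ∀ t i, η * ℓ t i < 1) (t : ℕ) : mwLaw τ η ℓ t ∈ stdSimplex ℝ ι :=
  weightLaw_mem_stdSimplex (mwWeight_pos hx t)

lemma sum_mwLaw_change_le (hη : 0 ≤ η) (hℓ : ∀ t i, 0 ≤ ℓ t i) (hx : ∀ t i, η * ℓ t i < 1)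
    (s : ℕ) :
    ∑ t ∈ Finset.Ioc (s * τ) (s * τ + τ), ∑ i, max (mwLaw τ η ℓ t i - mwLaw τ η ℓ (t + 1) i) 0 ≤
      η * ∑ t ∈ Finset.Ioc (s * τ) (s * τ + τ), ∑ i, mwLaw τ η ℓ t i * ℓ t i + 1 := by
  refine (sum_restartProd_succ_le (g := fun t => 1 - η • ℓ t)
    (D := fun w w' => ∑ i, max (weightLaw w i - weightLaw w' i) 0)
    (fun t => Finset.sum_nonneg fun i _ => le_max_right _ _) zero_le_one
    (fun t => sum_max_sub_le_one (mwLaw_mem_stdSimplex hx t) (mwLaw_mem_stdSimplex hx (t + 1)))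
    s).trans ?_
  rw [Finset.mul_sum]
  gcongr with t
  refine (sum_max_weightLaw_sub_le (mwWeight_pos hx t) (fun i => mul_nonneg hη (hℓ t i))
    (hx t)).trans_eq ?_
  rw [Finset.mul_sum]
  exact Finset.sum_congr rfl fun i _ => mul_left_comm _ _ _

lemma sum_mwLaw_loss_le (hη : 0 < η) (hℓ₀ : ∀ t i, 0 ≤ ℓ t i) (hℓ : ∀ t i, ℓ t i ≤ b)
    (hηb : η * b ≤ 1 / 2) (s : ℕ) (i : ι) :
    ∑ t ∈ Finset.Ioc (s * τ) (s * τ + τ), ∑ j, mwLaw τ η ℓ t j * ℓ t j ≤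
      (1 + η * b) * ∑ t ∈ Finset.Ioc (s * τ) (s * τ + τ), ℓ t i +
        Real.log (Fintype.card ι) / η := by
  have hx₀ (t j) : 0 ≤ η * ℓ t j := mul_nonneg hη.le (hℓ₀ t j)
  have hxb (t j) : η * ℓ t j ≤ η * b := mul_le_mul_of_nonneg_left (hℓ t j) hη.le
  have hx₁ (t j) : η * ℓ t j < 1 := ((hxb t j).trans hηb).trans_lt one_half_lt_one
  set block := Finset.Ioc (s * τ) (s * τ + τ)
  have potential_drop : Real.log (∑ j, ∏ t ∈ block, (1 - η * ℓ t j)) -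
      Real.log (Fintype.card ι) ≤ -(η * ∑ t ∈ block, ∑ j, mwLaw τ η ℓ t j * ℓ t j) := by
    have telescope := sum_restartProd_mul_sub (fun w : ι → ℝ => Real.log (∑ j, w j)) 1
      (fun t => 1 - η • ℓ t) s (le_refl τ)
    simp only [one_mul, Finset.prod_apply, Pi.sub_apply, Pi.smul_apply, smul_eq_mul, Pi.one_apply,
      Finset.sum_const, Finset.card_univ, nsmul_eq_mul, mul_one] at telescope
    rw [← telescope, Finset.mul_sum, ← Finset.sum_neg_distrib]
    refine Finset.sum_le_sum fun t _ => (sub_le_iff_le_add'.2 (log_sum_mul_one_sub_le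
      (mwWeight_pos hx₁ t) (hx₁ t))).trans_eq ?_
    simp only [Finset.mul_sum, mul_left_comm η]
    rfl
  have factor_prod_pos (j) : 0 < ∏ t ∈ block, (1 - η * ℓ t j) :=
    Finset.prod_pos fun t _ => sub_pos.2 (hx₁ t j)
  have expert_bound : -((1 + η * b) * ∑ t ∈ block, η * ℓ t i) ≤
      Real.log (∑ j, ∏ t ∈ block, (1 - η * ℓ t j)) :=
    (neg_mul_sum_le_log_prod_one_sub block (hx₀ · i) (hxb · i) hηb).trans <|
      Real.log_le_log (factor_prod_pos i) <| Finset.single_le_sum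
        (f := fun j => ∏ t ∈ block, (1 - η * ℓ t j)) (fun j _ => (factor_prod_pos j).le)
        (Finset.mem_univ i)
  rw [← Finset.mul_sum] at expert_bound
  rw [← mul_le_mul_iff_right₀ hη, mul_add, mul_div_cancel₀ _ hη.ne']
  linarith

end MultiplicativeWeights

lemma sqrt_div_mul {a x : ℝ} (ha : 0 ≤ a) (hx : 0 ≤ x) : √(a / x) * x = √(x * a) := by
  rw [Real.sqrt_div ha, div_mul_eq_mul_div, mul_div_assoc, Real.div_sqrt, Real.sqrt_mul hx,
    mul_comm]

lemma div_sqrt_div {a x : ℝ} (ha : 0 ≤ a) (hx : 0 ≤ x) : a / √(a / x) = √(x * a) := by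
  rw [Real.sqrt_div ha, div_div_eq_mul_div, mul_div_right_comm, Real.div_sqrt, Real.sqrt_mul hx,
    mul_comm]

lemma exists_block_expert_of_rate [Nonempty (Cache n k)] (τ : ℕ) {η : ℝ} (hk : 1 ≤ k)
    (hη : 0 < η) (hkη : k * η ≤ 1 / 4) :
    ∃ B : Algorithm n k, ∀ (r : ℕ → Fin n) (s : ℕ) (C : Cache n k),
      ∑ t ∈ Finset.Ioc (s * τ) (s * τ + τ), B.stepCost r t ≤
        ∑ t ∈ Finset.Ioc (s * τ) (s * τ + τ), missLoss (r t) C +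
          (2 * (Real.log (Fintype.card (Cache n k)) / η) + 8 * k * η * τ + k) := by
  have one_le_k : (1 : ℝ) ≤ k := by exact_mod_cast hk
  have η_le : η ≤ 1 / 4 := (le_mul_of_one_le_left hη.le one_le_k).trans hkη
  have factor_pos (r : ℕ → Fin n) (t) (C : Cache n k) : η * missLoss (r t) C < 1 := by
    nlinarith [missLoss_le (r t) C]
  let law (r : ℕ → Fin n) : ℕ → Cache n k → ℝ := mwLaw τ η fun t => missLoss (r t)
  have law_nonanticipating : Nonanticipating law := fun r r' t h =>
    congrArg weightLaw (restartProd_congr fun s hs hst =>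
      congrArg (fun i => 1 - η • missLoss i) (h s hs hst.le))
  obtain ⟨B, hB⟩ := exists_algorithm_of_laws law_nonanticipating fun r t =>
    mwLaw_mem_stdSimplex (factor_pos r) t
  refine ⟨B, fun r s C => ?_⟩
  set block := Finset.Ioc (s * τ) (s * τ + τ) with hblock
  set L := Real.log (Fintype.card (Cache n k))
  set Q := ∑ t ∈ block, ∑ C, law r t C * missLoss (r t) C
  set Λ := ∑ t ∈ block, missLoss (r t) C
  have : 0 ≤ L / η := div_nonneg (Real.log_natCast_nonneg _) hη.le
  have movement : ∑ t ∈ block, ∑ C, max (law r t C - law r (t + 1) C) 0 ≤ η * Q + 1 :=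
    sum_mwLaw_change_le hη.le (fun t => missLoss_nonneg (r t)) (factor_pos r) s
  have serving : Q ≤ (1 + η * 2) * Λ + L / η :=
    sum_mwLaw_loss_le hη (fun t => missLoss_nonneg (r t)) (fun t => missLoss_le (r t))
      (by linarith) s C
  have Λ_nonneg : 0 ≤ Λ := Finset.sum_nonneg fun t _ => missLoss_nonneg (r t) C
  have Λ_le : Λ ≤ 2 * τ := by
    refine (Finset.sum_le_card_nsmul block _ 2 fun t _ => missLoss_le (r t) C).trans_eq ?_
    simp [hblock, mul_comm]
  calc ∑ t ∈ block, B.stepCost r t ≤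
        ∑ t ∈ block, (∑ C, law r t C * missLoss (r t) C +
          k * ∑ C, max (law r t C - law r (t + 1) C) 0) := Finset.sum_le_sum fun t _ => hB r t
    _ ≤ Q + k * (η * Q + 1) := by
        rw [Finset.sum_add_distrib, ← Finset.mul_sum]
        gcongr
    _ = (1 + k * η) * Q + k := by ring
    _ ≤ (1 + k * η) * ((1 + η * 2) * Λ + L / η) + k := by gcongr
    _ = Λ + (k * η + 2 * η * (1 + k * η)) * Λ + (1 + k * η) * (L / η) + k := by ring
    _ ≤ Λ + 4 * (k * η) * (2 * τ) + 2 * (L / η) + k := by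
        gcongr ?_ + ?_ * ?_ + ?_ * ?_ + ?_ <;> nlinarith
    _ = _ := by ring

lemma exists_static_algorithm [Nonempty (Cache n k)] :
    ∃ B : Algorithm n k, ∀ r t, B.stepCost r t ≤ 2 := by
  classical
  obtain ⟨B, hB⟩ := exists_algorithm_of_laws (n := n) (k := k)
    (p := fun _ _ => Pi.single (Classical.arbitrary _) 1) (fun _ _ _ _ => rfl)
    fun _ _ => single_mem_stdSimplex ℝ _
  refine ⟨B, fun r t => (hB r t).trans ?_⟩
  simp [Pi.single_apply, missLoss_le]

lemma exists_block_expert (hk : 1 ≤ k) (hN : 2 ≤ Fintype.card (Cache n k)) {τ : ℕ} (hτ : 1 ≤ τ) :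
    ∃ B : Algorithm n k, ∀ (r : ℕ → Fin n) (s : ℕ) (C : Cache n k),
      ∑ t ∈ Finset.Ioc (s * τ) (s * τ + τ), B.stepCost r t ≤
        ∑ t ∈ Finset.Ioc (s * τ) (s * τ + τ), missLoss (r t) C +
          (10 * √(k * τ * Real.log (Fintype.card (Cache n k))) + k) := by
  have : Nonempty (Cache n k) := Fintype.card_pos_iff.1 (by omega)
  set L := Real.log (Fintype.card (Cache n k))
  have L_pos : 0 < L := Real.log_pos (by exact_mod_cast hN)
  have k_pos : (0 : ℝ) < k := by exact_mod_cast hk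
  have τ_pos : (0 : ℝ) < τ := by exact_mod_cast hτ
  have kτ_pos : (0 : ℝ) < k * τ := mul_pos k_pos τ_pos
  rcases le_or_gt (16 * k * L) τ with block_long | block_short
  · have k_mul_rate_le : k * √(L / (k * τ)) ≤ 1 / 4 := by
      rw [← le_div_iff₀' k_pos]
      refine Real.sqrt_le_iff.2 ⟨by positivity, ?_⟩
      rw [div_pow, div_le_div_iff₀ kτ_pos (by positivity)]
      nlinarith
    obtain ⟨B, hB⟩ := exists_block_expert_of_rate (n := n) τ hk
      (Real.sqrt_pos.2 (div_pos L_pos kτ_pos)) k_mul_rate_le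
    refine ⟨B, fun r s C => (hB r s C).trans_eq ?_⟩
    rw [div_sqrt_div L_pos.le kτ_pos.le, ← sqrt_div_mul L_pos.le kτ_pos.le]
    ring
  · obtain ⟨B, hB⟩ := exists_static_algorithm (n := n) (k := k)
    refine ⟨B, fun r s C => ?_⟩
    have τ_le : τ ≤ 4 * √(k * τ * L) := by
      rw [← div_le_iff₀' (by norm_num)]
      refine Real.le_sqrt_of_sq_le ?_
      nlinarith
    have cost_le : ∑ t ∈ Finset.Ioc (s * τ) (s * τ + τ), B.stepCost r t ≤ τ * 2 := by
      simpa using Finset.sum_le_card_nsmul (Finset.Ioc (s * τ) (s * τ + τ)) _ 2 fun t _ => hB r t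
    have := Finset.sum_nonneg fun t (_ : t ∈ Finset.Ioc (s * τ) (s * τ + τ)) =>
      missLoss_nonneg (r t) C
    linarith [Real.sqrt_nonneg (k * τ * L)]

section Prod

/-- The probability of following an expert of weight `v` rather than a default expert of weight
one. -/
noncomputable def share (v : ℝ) : ℝ := v / (1 + v)

lemma share_nonneg {v : ℝ} (hv : 0 ≤ v) : 0 ≤ share v := by unfold share; positivity

lemma share_le_one {v : ℝ} (hv : 0 ≤ v) : share v ≤ 1 :=
  (div_le_one (by linarith)).2 (by linarith)

lemma share_le_self {v : ℝ} (hv : 0 ≤ v) : share v ≤ v := div_le_self hv (by linarith)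

lemma abs_share_sub_share_le {v w : ℝ} (hv : 0 ≤ v) (hw : 0 ≤ w) :
    |share v - share w| ≤ max (share v) (share w) :=
  abs_sub_le_iff.2
    ⟨(sub_le_self _ (share_nonneg hw)).trans (le_max_left _ _),
      (sub_le_self _ (share_nonneg hv)).trans (le_max_right _ _)⟩

lemma share_le_log {v : ℝ} (hv : 0 ≤ v) : share v ≤ Real.log (1 + v) := by
  have one_add_pos : 0 < 1 + v := by linarith
  refine le_trans (le_of_eq ?_) (Real.one_sub_inv_le_log_of_pos one_add_pos)
  unfold share
  field_simp
  ring

lemma log_one_add_mul_le {v x : ℝ} (hv : 0 ≤ v) (hx : -1 < x) :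
    Real.log (1 + v * (1 + x)) ≤ Real.log (1 + v) + share v * x := by
  have one_add_pos : 0 < 1 + v := by linarith
  have factorization : 1 + v * (1 + x) = (1 + v) * (1 + share v * x) := by
    unfold share
    field_simp
    ring
  have factor_pos : 0 < 1 + share v * x := by nlinarith [share_nonneg hv, share_le_one hv]
  rw [factorization, Real.log_mul one_add_pos.ne' factor_pos.ne']
  linarith [Real.log_le_sub_one_of_pos factor_pos]

lemma abs_share_mul_sub_le {v x : ℝ} (hv : 0 ≤ v) (hx : -1 ≤ x) :
    |share (v * (1 + x)) - share v| ≤ share v * |x| := by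
  have : 0 < 1 + v := by linarith
  have one_le_denominator : 1 ≤ 1 + v * (1 + x) := by nlinarith
  have difference_eq : share (v * (1 + x)) - share v = share v * x / (1 + v * (1 + x)) := by
    have : 1 + v * (1 + x) ≠ 0 := by linarith
    unfold share
    field_simp
    ring
  rw [difference_eq, abs_div, abs_mul, abs_of_nonneg (share_nonneg hv),
    abs_of_pos (by linarith : 0 < 1 + v * (1 + x))]
  exact div_le_self (mul_nonneg (share_nonneg hv) (abs_nonneg _)) one_le_denominator

/-- The relative change of an expert's weight after a step in which it gains `x`. The reduction of
the gain by `2 * η` pays for the change of the share. -/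
def prodIncrement (η x : ℝ) : ℝ := η * (x - 2 * η)

/-- The weight of an expert with gains `d t` relative to a default expert; it restarts from `Z`
after every `τ` steps. -/
noncomputable def prodWeight (τ : ℕ) (η Z : ℝ) (d : ℕ → ℝ) : ℕ → ℝ :=
  restartProd τ Z fun t => 1 + prodIncrement η (d t)

/-- The expected gain over the default expert in a step where the expert gains `x` and its weight
changes from `v` to `v'`, minus the probability of a switch. -/
noncomputable def netGain (x v v' : ℝ) : ℝ := share v * x - |share v' - share v|

variable {τ : ℕ} {η Z x v : ℝ} {d : ℕ → ℝ}

lemma abs_prodIncrement_le (hη₀ : 0 ≤ η) (hη : η ≤ 1 / 4) (hx : |x| ≤ 1) :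
    |prodIncrement η x| ≤ 2 * η := by
  obtain ⟨hx₀, hx₁⟩ := abs_le.1 hx
  rw [prodIncrement, abs_le]
  constructor <;> nlinarith

lemma neg_one_lt_prodIncrement (hη₀ : 0 ≤ η) (hη : η ≤ 1 / 4) (hx : |x| ≤ 1) :
    -1 < prodIncrement η x := by
  linarith [neg_le_of_abs_le (abs_prodIncrement_le hη₀ hη hx)]

lemma mul_one_add_prodIncrement_pos (hη₀ : 0 ≤ η) (hη : η ≤ 1 / 4) (hx : |x| ≤ 1) (hv : 0 < v) :
    0 < v * (1 + prodIncrement η x) :=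
  mul_pos hv (by linarith [neg_one_lt_prodIncrement hη₀ hη hx])

lemma prodWeight_pos (hη₀ : 0 ≤ η) (hη : η ≤ 1 / 4) (hZ : 0 < Z) (hd : ∀ t, |d t| ≤ 1) (t : ℕ) :
    0 < prodWeight τ η Z d t :=
  restartProd_induction hZ (fun t _ => mul_one_add_prodIncrement_pos hη₀ hη (hd t)) t

/-- The potential function of the Prod analysis: its increase is paid for by the net gain. -/
noncomputable def prodPotential (η v : ℝ) : ℝ := Real.log (1 + v) / η

lemma prodPotential_nonneg (hη₀ : 0 ≤ η) (hv : 0 ≤ v) : 0 ≤ prodPotential η v :=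
  div_nonneg (Real.log_nonneg (by linarith)) hη₀

lemma prodPotential_le (hη₀ : 0 ≤ η) (hv : 0 ≤ v) : prodPotential η v ≤ v / η := by
  refine div_le_div_of_nonneg_right ?_ hη₀
  linarith [Real.log_le_sub_one_of_pos (show 0 < 1 + v by linarith)]

lemma prodPotential_sub_le_netGain (hη₀ : 0 < η) (hη : η ≤ 1 / 4) (hv : 0 ≤ v) (hx : |x| ≤ 1) :
    prodPotential η (v * (1 + prodIncrement η x)) - prodPotential η v ≤
      netGain x v (v * (1 + prodIncrement η x)) := by
  have lower := neg_one_lt_prodIncrement hη₀.le hη hx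
  have log_le := log_one_add_mul_le hv lower
  have move_le := (abs_share_mul_sub_le hv lower.le).trans
    (mul_le_mul_of_nonneg_left (abs_prodIncrement_le hη₀.le hη hx) (share_nonneg hv))
  have : share v * prodIncrement η x = η * (share v * x - share v * (2 * η)) := by
    rw [prodIncrement]; ring
  rw [prodPotential, prodPotential, netGain, ← sub_div, div_le_iff₀ hη₀]
  nlinarith

/-- A restart may drop the share to almost nothing, but the lost share is at most the lost
potential. -/
lemma prodPotential_sub_le_netGain_restart (hη₀ : 0 < η) (hη : η ≤ 1 / 4) (hZ : 0 < Z) (hv : 0 ≤ v)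
    (hx : |x| ≤ 1) : prodPotential η Z - prodPotential η v - (Z / η + Z) ≤ netGain x v Z := by
  set v' := v * (1 + prodIncrement η x)
  have v'_nonneg : 0 ≤ v' :=
    mul_nonneg hv (by linarith [neg_one_lt_prodIncrement hη₀.le hη hx])
  have gain_without_restart := prodPotential_sub_le_netGain hη₀ hη hv hx
  have share_le_potential : share v' ≤ prodPotential η v' :=
    (share_le_log v'_nonneg).trans
      (le_div_self (Real.log_nonneg (by linarith)) hη₀ (by linarith))
  have extra_move : |share Z - share v| ≤ |share v' - share v| + (share v' + Z) := by
    have := abs_sub_le (share Z) (share v') (share v)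
    have := (abs_share_sub_share_le hZ.le v'_nonneg).trans
      (max_le_add_of_nonneg (share_nonneg hZ.le) (share_nonneg v'_nonneg))
    linarith [share_le_self hZ.le]
  rw [netGain] at gain_without_restart ⊢
  linarith [prodPotential_le hη₀.le hZ.le]

lemma prodPotential_sub_le_netGain_prodWeight (hη₀ : 0 < η) (hη : η ≤ 1 / 4) (hZ : 0 < Z)
    (hd : ∀ t, |d t| ≤ 1) (t : ℕ) :
    prodPotential η (prodWeight τ η Z d (t + 1)) - prodPotential η (prodWeight τ η Z d t) -
      (Z / η + Z) ≤ netGain (d t) (prodWeight τ η Z d t) (prodWeight τ η Z d (t + 1)) := by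
  have weight_nonneg := (prodWeight_pos (τ := τ) hη₀.le hη hZ hd t).le
  rw [prodWeight] at weight_nonneg ⊢
  rw [restartProd]
  split_ifs
  · exact prodPotential_sub_le_netGain_restart hη₀ hη hZ weight_nonneg (hd t)
  · have : 0 ≤ Z / η + Z := by positivity
    linarith [prodPotential_sub_le_netGain hη₀ hη weight_nonneg (hd t)]

lemma prodWeight_block_start (s : ℕ) : prodWeight τ η Z d (s * τ + 1) = Z :=
  if_pos (dvd_mul_left τ s)

lemma neg_le_sum_netGain (hη₀ : 0 < η) (hη : η ≤ 1 / 4) (hZ : 0 < Z) (hd : ∀ t, |d t| ≤ 1)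
    (s m : ℕ) :
    -((m + 1) * (Z / η + Z)) ≤ ∑ t ∈ Finset.Ioc (s * τ) (s * τ + m),
      netGain (d t) (prodWeight τ η Z d t) (prodWeight τ η Z d (t + 1)) := by
  have telescope : prodPotential η (prodWeight τ η Z d (s * τ + m + 1)) - prodPotential η Z -
      m * (Z / η + Z) ≤ ∑ t ∈ Finset.Ioc (s * τ) (s * τ + m),
        netGain (d t) (prodWeight τ η Z d t) (prodWeight τ η Z d (t + 1)) := by
    induction m with
    | zero => simp [prodWeight_block_start]
    | succ m ih =>
      rw [← add_assoc, Finset.sum_Ioc_succ_top (by omega)]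
      push_cast
      linarith [prodPotential_sub_le_netGain_prodWeight (τ := τ) hη₀ hη hZ hd (s * τ + m + 1)]
  linarith [prodPotential_le hη₀.le hZ.le, prodPotential_nonneg hη₀.le
    (prodWeight_pos (τ := τ) hη₀.le hη hZ hd (s * τ + m + 1)).le]

lemma le_log_one_add_prodIncrement (hη₀ : 0 ≤ η) (hη : η ≤ 1 / 4) (hx : |x| ≤ 1) :
    η * x - 6 * η ^ 2 ≤ Real.log (1 + prodIncrement η x) := by
  have abs_le := abs_prodIncrement_le hη₀ hη hx
  refine le_trans ?_ (sub_sq_le_log_one_add (abs_le.trans (by linarith)))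
  have : prodIncrement η x ^ 2 ≤ (2 * η) ^ 2 := sq_le_sq' (neg_le_of_abs_le abs_le)
    (le_of_abs_le abs_le)
  rw [show prodIncrement η x = η * x - 2 * η ^ 2 by rw [prodIncrement]; ring] at this ⊢
  linarith

lemma le_prodPotential_block (hη₀ : 0 < η) (hη : η ≤ 1 / 4) (hZ : 0 < Z) (hd : ∀ t, |d t| ≤ 1)
    (S : Finset ℕ) :
    ∑ t ∈ S, d t + Real.log Z / η - 6 * η * S.card ≤
      prodPotential η (Z * ∏ t ∈ S, (1 + prodIncrement η (d t))) := by
  have factor_pos (t) : 0 < 1 + prodIncrement η (d t) := by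
    linarith [neg_one_lt_prodIncrement hη₀.le hη (hd t)]
  have prod_pos := Finset.prod_pos fun t (_ : t ∈ S) => factor_pos t
  rw [prodPotential, le_div_iff₀ hη₀]
  calc (∑ t ∈ S, d t + Real.log Z / η - 6 * η * S.card) * η
      = Real.log Z + ∑ t ∈ S, (η * d t - 6 * η ^ 2) := by
        rw [Finset.sum_sub_distrib, ← Finset.mul_sum, Finset.sum_const, nsmul_eq_mul]
        field_simp
        ring
    _ ≤ Real.log Z + ∑ t ∈ S, Real.log (1 + prodIncrement η (d t)) := by
        gcongr with t
        exact le_log_one_add_prodIncrement hη₀.le hη (hd t)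
    _ = Real.log (Z * ∏ t ∈ S, (1 + prodIncrement η (d t))) := by
        rw [Real.log_mul hZ.ne' prod_pos.ne', Real.log_prod fun t _ => (factor_pos t).ne']
    _ ≤ _ := Real.log_le_log (mul_pos hZ prod_pos) (by linarith)

lemma le_sum_netGain_block (hη₀ : 0 < η) (hη : η ≤ 1 / 4) (hZ : 0 < Z) (hd : ∀ t, |d t| ≤ 1)
    (s : ℕ) :
    ∑ t ∈ Finset.Ioc (s * τ) (s * τ + τ), d t -
        (-Real.log Z / η + 6 * η * τ + Z / η + 1) ≤
      ∑ t ∈ Finset.Ioc (s * τ) (s * τ + τ),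
        netGain (d t) (prodWeight τ η Z d t) (prodWeight τ η Z d (t + 1)) := by
  set block := Finset.Ioc (s * τ) (s * τ + τ) with hblock
  set w := prodWeight τ η Z d
  have w_pos (t) : 0 < w t := prodWeight_pos hη₀.le hη hZ hd t
  have moves : ∑ t ∈ block, |share (w (t + 1)) - share (w t)| ≤
      ∑ t ∈ block, |share (w t * (1 + prodIncrement η (d t))) - share (w t)| + 1 :=
    sum_restartProd_succ_le (D := fun v v' => |share v' - share v|) (fun t => abs_nonneg _)
      zero_le_one (fun t => (abs_share_sub_share_le (w_pos _).le (w_pos t).le).trans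
        (max_le (share_le_one (w_pos _).le) (share_le_one (w_pos t).le))) s
  have potential_increase : prodPotential η (Z * ∏ t ∈ block, (1 + prodIncrement η (d t))) -
      prodPotential η Z ≤ ∑ t ∈ block, netGain (d t) (w t) (w t * (1 + prodIncrement η (d t))) := by
    rw [← sum_restartProd_mul_sub (prodPotential η) Z _ s (le_refl τ)]
    exact Finset.sum_le_sum fun t _ => prodPotential_sub_le_netGain hη₀ hη (w_pos t).le (hd t)
  have final_potential := le_prodPotential_block hη₀ hη hZ hd block
  simp only [hblock, Nat.card_Ioc, Nat.add_sub_cancel_left] at final_potential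
  simp only [netGain, Finset.sum_sub_distrib] at potential_increase ⊢
  rw [neg_div]
  linarith [prodPotential_le hη₀.le hZ.le]

end Prod

section Combine

/-- How much cheaper a step of `B` is than one of `A`, scaled into `[-1, 1]`. -/
noncomputable def relativeGain (A B : Algorithm n k) (r : ℕ → Fin n) (t : ℕ) : ℝ :=
  (A.stepCost r t - B.stepCost r t) / (3 * k)

/-- The Prod mixture of the default algorithm `A` and the algorithm `B`, restarted after every `τ`
steps with weight `Z` on `B`. -/
noncomputable def combine (A B : Algorithm n k) (τ : ℕ) (η Z : ℝ) : Algorithm n k :=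
  mix A B fun r t => share (prodWeight τ η Z (relativeGain A B r) t)

variable {τ : ℕ} {η Z : ℝ}

lemma abs_relativeGain_le (hk : 1 ≤ k) (A B : Algorithm n k) (r : ℕ → Fin n) (t : ℕ) :
    |relativeGain A B r t| ≤ 1 := by
  have one_le_k : (1 : ℝ) ≤ k := by exact_mod_cast hk
  rw [relativeGain, abs_div, abs_of_pos (by positivity : (0 : ℝ) < 3 * k),
    div_le_one (by positivity), abs_le]
  constructor <;>
    linarith [A.stepCost_nonneg r t, A.stepCost_le r t, B.stepCost_nonneg r t, B.stepCost_le r t]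

lemma nonanticipating_prodWeight (A B : Algorithm n k) :
    Nonanticipating fun r t => prodWeight τ η Z (relativeGain A B r) t := by
  refine fun r r' t h => restartProd_congr fun s hs hst => ?_
  have h' : ∀ u, 1 ≤ u → u ≤ s + 1 → r u = r' u := fun u hu hus => h u hu (hus.trans hst)
  rw [relativeGain, relativeGain, A.stepCost_congr hs h', B.stepCost_congr hs h']

lemma stepCost_combine_le (hk : 1 ≤ k) (A B : Algorithm n k) (hη₀ : 0 ≤ η) (hη : η ≤ 1 / 4)
    (hZ : 0 < Z) (r : ℕ → Fin n) (t : ℕ) :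
    (combine A B τ η Z).stepCost r t ≤ A.stepCost r t - 3 * k *
      netGain (relativeGain A B r t) (prodWeight τ η Z (relativeGain A B r) t)
        (prodWeight τ η Z (relativeGain A B r) (t + 1)) := by
  have : (0 : ℝ) < k := by exact_mod_cast hk
  have weight_nonneg (r t) : 0 ≤ prodWeight τ η Z (relativeGain A B r) t :=
    (prodWeight_pos hη₀ hη hZ (abs_relativeGain_le hk A B r) t).le
  have step := stepCost_mix_le A B (p := fun r t => share (prodWeight τ η Z (relativeGain A B r) t))
    (fun r r' t h => congrArg share (nonanticipating_prodWeight A B h))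
    (fun r t => share_nonneg (weight_nonneg r t)) (fun r t => share_le_one (weight_nonneg r t)) r t
  have gain_eq : 3 * k * relativeGain A B r t = A.stepCost r t - B.stepCost r t :=
    mul_div_cancel₀ _ (by positivity)
  set move := |share (prodWeight τ η Z (relativeGain A B r) (t + 1)) -
    share (prodWeight τ η Z (relativeGain A B r) t)|
  have move_nonneg : 0 ≤ move * k := by positivity
  rw [netGain, mul_sub, mul_left_comm, gain_eq]
  rw [← combine] at step
  linarith

lemma sum_stepCost_combine_le (hk : 1 ≤ k) (A B : Algorithm n k) (hη₀ : 0 ≤ η) (hη : η ≤ 1 / 4)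
    (hZ : 0 < Z) (r : ℕ → Fin n) (S : Finset ℕ) :
    ∑ t ∈ S, (combine A B τ η Z).stepCost r t ≤ ∑ t ∈ S, A.stepCost r t - 3 * k * ∑ t ∈ S,
      netGain (relativeGain A B r t) (prodWeight τ η Z (relativeGain A B r) t)
        (prodWeight τ η Z (relativeGain A B r) (t + 1)) := by
  rw [Finset.mul_sum, ← Finset.sum_sub_distrib]
  exact Finset.sum_le_sum fun t _ => stepCost_combine_le hk A B hη₀ hη hZ r t

lemma sum_stepCost_combine_le_default (hk : 1 ≤ k) (A B : Algorithm n k) (hη₀ : 0 < η)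
    (hη : η ≤ 1 / 4) (hZ : 0 < Z) (r : ℕ → Fin n) (s m : ℕ) :
    ∑ t ∈ Finset.Ioc (s * τ) (s * τ + m), (combine A B τ η Z).stepCost r t ≤
      ∑ t ∈ Finset.Ioc (s * τ) (s * τ + m), A.stepCost r t +
        3 * k * ((m + 1) * (Z / η + Z)) := by
  refine (sum_stepCost_combine_le hk A B hη₀.le hη hZ r _).trans ?_
  rw [sub_eq_add_neg, ← mul_neg]
  gcongr
  exact neg_le.1 (neg_le_sum_netGain hη₀ hη hZ (abs_relativeGain_le hk A B r) s m)

lemma sum_stepCost_combine_le_expert (hk : 1 ≤ k) (A B : Algorithm n k) (hη₀ : 0 < η)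
    (hη : η ≤ 1 / 4) (hZ : 0 < Z) (r : ℕ → Fin n) (s : ℕ) :
    ∑ t ∈ Finset.Ioc (s * τ) (s * τ + τ), (combine A B τ η Z).stepCost r t ≤
      ∑ t ∈ Finset.Ioc (s * τ) (s * τ + τ), B.stepCost r t +
        3 * k * (-Real.log Z / η + 6 * η * τ + Z / η + 1) := by
  refine (sum_stepCost_combine_le hk A B hη₀.le hη hZ r _).trans ?_
  have : (0 : ℝ) < k := by exact_mod_cast hk
  have gain_ge := mul_le_mul_of_nonneg_left
    (le_sum_netGain_block (τ := τ) hη₀ hη hZ (abs_relativeGain_le hk A B r) s)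
    (by positivity : (0 : ℝ) ≤ 3 * k)
  have sum_gain_eq : 3 * k * ∑ t ∈ Finset.Ioc (s * τ) (s * τ + τ), relativeGain A B r t =
      ∑ t ∈ Finset.Ioc (s * τ) (s * τ + τ), A.stepCost r t -
        ∑ t ∈ Finset.Ioc (s * τ) (s * τ + τ), B.stepCost r t := by
    rw [Finset.mul_sum, ← Finset.sum_sub_distrib]
    exact Finset.sum_congr rfl fun t _ => mul_div_cancel₀ _ (by positivity)
  rw [mul_sub, sum_gain_eq] at gain_ge
  linarith

end Combine

section RandomOrder

variable {ι α : Type*} [LinearOrder α]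

/-- The number of elements of `U` that precede `i` in the order pulled back along `f`. -/
def rankIn (f : ι → α) (U : Finset ι) (i : ι) : ℕ :=
  {j ∈ U | f j < f i}.card

/-- The first `q` elements of `U` in the order pulled back along `f`. -/
def initialElements (f : ι → α) (U : Finset ι) (q : ℕ) : Finset ι :=
  {i ∈ U | rankIn f U i < q}

variable {f : ι → α} {U : Finset ι} {q : ℕ} {i j : ι}

lemma initialElements_subset : initialElements f U q ⊆ U := Finset.filter_subset _ _

lemma rankIn_lt_rankIn (hi : i ∈ U) (h : f i < f j) : rankIn f U i < rankIn f U j := by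
  refine Finset.card_lt_card (Finset.ssubset_iff_of_subset ?_ |>.2 ⟨i, by simp [hi, h], by simp⟩)
  exact Finset.monotone_filter_right _ fun l _ hl => hl.trans h

lemma rankIn_injOn (hf : f.Injective) : Set.InjOn (rankIn f U) U := by
  intro i hi j hj h
  by_contra hij
  rcases lt_or_gt_of_ne (hf.ne hij) with h_lt | h_gt
  · exact (rankIn_lt_rankIn hi h_lt).ne h
  · exact (rankIn_lt_rankIn hj h_gt).ne' h

lemma rankIn_lt_card (hi : i ∈ U) : rankIn f U i < U.card :=
  Finset.card_lt_card (Finset.filter_ssubset.2 ⟨i, hi, lt_irrefl _⟩)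

lemma image_rankIn (hf : f.Injective) : U.image (rankIn f U) = Finset.range U.card := by
  refine Finset.eq_of_subset_of_card_le (Finset.image_subset_iff.2 fun i hi =>
    Finset.mem_range.2 (rankIn_lt_card hi)) ?_
  rw [Finset.card_image_of_injOn (rankIn_injOn hf), Finset.card_range]

lemma card_initialElements (hf : f.Injective) (hq : q ≤ U.card) :
    (initialElements f U q).card = q := by
  have ranks : (initialElements f U q).image (rankIn f U) = Finset.range q := by
    rw [initialElements, ← Finset.filter_image (p := (· < q)), image_rankIn hf]
    ext
    simp only [Finset.mem_filter, Finset.mem_range]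
    omega
  have rank_injOn : Set.InjOn (rankIn f U) (initialElements f U q) :=
    (rankIn_injOn hf).mono (Finset.coe_subset.2 initialElements_subset)
  rw [← Finset.card_image_of_injOn rank_injOn, ranks, Finset.card_range]

variable [DecidableEq ι]

lemma initialElements_erase_subset :
    initialElements f (U.erase i) q ⊆ initialElements f U (q + 1) := by
  intro j hj
  simp only [initialElements, Finset.mem_filter] at hj ⊢
  refine ⟨Finset.mem_of_mem_erase hj.1, ?_⟩
  have rank_le : rankIn f U j ≤ rankIn f (U.erase i) j + 1 := by
    rw [rankIn, rankIn, Finset.filter_erase]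
    exact Nat.le_add_of_sub_le Finset.pred_card_le_card_erase
  omega

lemma rankIn_comp_swap (hi : i ∈ U) (hj : j ∈ U) :
    rankIn (f ∘ Equiv.swap i j) U i = rankIn f U j := by
  refine Finset.card_equiv (Equiv.swap i j) fun l => ?_
  have : Equiv.swap i j l ∈ U ↔ l ∈ U := by
    rw [Equiv.swap_apply_def]
    split_ifs with h_i h_j <;> simp [*]
  simp [this]

lemma card_perm_mem_initialElements [Fintype α] {U : Finset α} {i : α} (hq : q ≤ U.card)
    (hi : i ∈ U) :
    U.card * Finset.card {σ : Equiv.Perm α | i ∈ initialElements σ U q} =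
      Fintype.card (Equiv.Perm α) * q := by
  refine Finset.card_mul_eq_card_mul (t := .univ) (fun j (σ : Equiv.Perm α) =>
    j ∈ initialElements σ U q) (fun j hj => ?_) fun σ _ => ?_
  · refine Finset.card_equiv (Equiv.mulRight (Equiv.swap i j)) fun σ => ?_
    simp [initialElements, hi, hj, Equiv.Perm.coe_mul, rankIn_comp_swap]
  · rw [Finset.bipartiteBelow, Finset.filter_mem_eq_inter,
      Finset.inter_eq_right.2 initialElements_subset, card_initialElements σ.injective hq]

end RandomOrder

lemma harmonic_mono : Monotone harmonic :=
  fun _ _ h => Finset.sum_le_sum_of_subset_of_nonneg (Finset.range_mono h)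
    fun _ _ _ => by positivity

lemma one_le_harmonic {m : ℕ} (hm : 1 ≤ m) : 1 ≤ harmonic m := by
  simpa [harmonic] using harmonic_mono hm

/-- A state of the marking algorithm: the marked pages, which are the pages requested in the current
phase, and the pages that were marked at the end of the previous phase. -/
structure MarkState (n : ℕ) where
  marked : Finset (Fin n)
  previous : Finset (Fin n)

namespace MarkState

/-- The transition of the marking algorithm: a new phase starts when `k` pages are marked and
another page is requested. -/
def next (k : ℕ) (X : MarkState n) (i : Fin n) : MarkState n :=
  if i ∈ X.marked then X
  else if X.marked.card = k then ⟨{i}, X.marked⟩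
  else ⟨insert i X.marked, X.previous⟩

/-- One for a clean request, that is, for a page requested neither earlier in the phase nor in the
phase before it, and zero for any other request. -/
def clean (k : ℕ) (X : MarkState n) (i : Fin n) : ℝ :=
  if i ∈ X.marked then 0 else if X.marked.card = k then 1 else if i ∈ X.previous then 0 else 1

/-- The cache of the marking algorithm: the marked pages, filled up with the pages of the previous
phase that come first in the random order `σ`. -/
def cacheSet (k : ℕ) (X : MarkState n) (σ : Equiv.Perm (Fin n)) : Finset (Fin n) :=
  X.marked ∪ initialElements σ (X.previous \ X.marked) (k - X.marked.card)

/-- The invariant of the states that occur in the marking algorithm. -/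
structure Valid (k : ℕ) (X : MarkState n) : Prop where
  card_marked_le : X.marked.card ≤ k
  card_previous : X.previous.card = k

/-- The number of clean pages marked in the current phase. -/
def cleanMarked (X : MarkState n) : ℕ := (X.marked \ X.previous).card

/-- The number of pages of the previous phase that are not yet marked. -/
def stale (X : MarkState n) : ℕ := (X.previous \ X.marked).card

/-- The probability, over a uniformly random order, that a page is not in the cache. -/
noncomputable def faultProb (k : ℕ) (X : MarkState n) (i : Fin n) : ℝ :=
  Finset.card {σ : Equiv.Perm (Fin n) | i ∉ X.cacheSet k σ} / Fintype.card (Equiv.Perm (Fin n))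

variable {X : MarkState n} {i : Fin n}

lemma next_of_mem (hi : i ∈ X.marked) : X.next k i = X := if_pos hi

lemma next_of_card_eq (hi : i ∉ X.marked) (hX : X.marked.card = k) :
    X.next k i = ⟨{i}, X.marked⟩ := by
  rw [next, if_neg hi, if_pos hX]

lemma next_of_card_ne (hi : i ∉ X.marked) (hX : X.marked.card ≠ k) :
    X.next k i = ⟨insert i X.marked, X.previous⟩ := by
  rw [next, if_neg hi, if_neg hX]

lemma clean_le_one (k : ℕ) (X : MarkState n) (i : Fin n) : X.clean k i ≤ 1 := by
  unfold clean
  split_ifs <;> norm_num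

lemma mem_marked_next (k : ℕ) (X : MarkState n) (i : Fin n) : i ∈ (X.next k i).marked := by
  unfold next
  split_ifs with h <;> simp [h]

lemma Valid.next (h : X.Valid k) (hk : 1 ≤ k) (i : Fin n) : (X.next k i).Valid k := by
  by_cases hi : i ∈ X.marked
  · rwa [next_of_mem hi]
  by_cases full : X.marked.card = k
  · rw [next_of_card_eq hi full]
    exact ⟨hk, full⟩
  · rw [next_of_card_ne hi full]
    refine ⟨?_, h.card_previous⟩
    rw [Finset.card_insert_of_notMem hi]
    exact lt_of_le_of_ne h.card_marked_le full

lemma Valid.sub_card_marked_le_stale (h : X.Valid k) : k - X.marked.card ≤ X.stale :=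
  h.card_previous ▸ Finset.le_card_sdiff X.marked X.previous

lemma Valid.stale_eq (h : X.Valid k) : X.stale = k - X.marked.card + X.cleanMarked := by
  have := Finset.card_sdiff_add_card X.previous X.marked
  have := Finset.card_sdiff_add_card X.marked X.previous
  rw [Finset.union_comm] at this
  have := h.card_marked_le
  have := h.card_previous
  rw [stale, cleanMarked]
  omega

lemma Valid.card_cacheSet (h : X.Valid k) (σ : Equiv.Perm (Fin n)) :
    (X.cacheSet k σ).card = k := by
  rw [cacheSet, Finset.card_union_of_disjoint
    (Finset.disjoint_sdiff.mono_right initialElements_subset),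
    card_initialElements σ.injective h.sub_card_marked_le_stale]
  exact Nat.add_sub_cancel' h.card_marked_le

lemma Valid.cacheSet_next_subset (h : X.Valid k) (i : Fin n) (σ : Equiv.Perm (Fin n)) :
    (X.next k i).cacheSet k σ ⊆ insert i (X.cacheSet k σ) := by
  by_cases hi : i ∈ X.marked
  · rw [next_of_mem hi]
    exact Finset.subset_insert _ _
  by_cases full : X.marked.card = k
  · rw [next_of_card_eq hi full]
    exact Finset.union_subset (by simp) <| initialElements_subset.trans <|
      Finset.sdiff_subset.trans <| Finset.subset_union_left.trans (Finset.subset_insert _ _)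
  · rw [next_of_card_ne hi full]
    have fill_subset := initialElements_erase_subset (f := σ) (U := X.previous \ X.marked)
      (q := k - (X.marked.card + 1)) (i := i)
    have : k - (X.marked.card + 1) + 1 = k - X.marked.card := by
      have := h.card_marked_le
      omega
    rw [cacheSet, cacheSet, Finset.insert_union, Finset.card_insert_of_notMem hi,
      Finset.sdiff_insert]
    rw [this] at fill_subset
    exact Finset.insert_subset_insert _ (Finset.union_subset_union_right fill_subset)

lemma faultProb_nonneg (k : ℕ) (X : MarkState n) (i : Fin n) : 0 ≤ X.faultProb k i := by
  unfold faultProb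
  positivity

lemma faultProb_le_one (k : ℕ) (X : MarkState n) (i : Fin n) : X.faultProb k i ≤ 1 :=
  div_le_one_of_le₀ (Nat.cast_le.2 (Finset.card_le_univ _)) (Nat.cast_nonneg _)

lemma faultProb_of_mem (hi : i ∈ X.marked) : X.faultProb k i = 0 := by
  simp [faultProb, cacheSet, hi]

lemma Valid.faultProb_of_stale (h : X.Valid k) (hi : i ∉ X.marked) (hi' : i ∈ X.previous) :
    X.faultProb k i = X.cleanMarked / X.stale := by
  have i_stale : i ∈ X.previous \ X.marked := Finset.mem_sdiff.2 ⟨hi', hi⟩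
  have : (X.stale : ℝ) ≠ 0 := by exact_mod_cast (Finset.card_pos.2 ⟨i, i_stale⟩).ne'
  have : (Fintype.card (Equiv.Perm (Fin n)) : ℝ) ≠ 0 := by exact_mod_cast Fintype.card_ne_zero
  have hits : (X.stale : ℝ) * Finset.card {σ : Equiv.Perm (Fin n) | i ∈ X.cacheSet k σ} =
      Fintype.card (Equiv.Perm (Fin n)) * (X.stale - X.cleanMarked) := by
    rw [h.stale_eq, Nat.cast_add, add_sub_cancel_right, ← Nat.cast_add, ← h.stale_eq]
    simpa [cacheSet, stale, hi] using congrArg (Nat.cast (R := ℝ))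
      (card_perm_mem_initialElements h.sub_card_marked_le_stale i_stale)
  have hits_add_faults := Finset.card_filter_add_card_filter_not (s := .univ)
    (fun σ : Equiv.Perm (Fin n) => i ∈ X.cacheSet k σ)
  rw [faultProb, div_eq_div_iff ‹_› ‹_›]
  rw [Finset.card_univ, ← Nat.cast_inj (R := ℝ), Nat.cast_add] at hits_add_faults
  linear_combination X.stale * hits_add_faults - hits

/-- A potential function for the expected number of faults of the marking algorithm after `N` clean
requests. -/
noncomputable def potential (k : ℕ) (X : MarkState n) (N : ℝ) : ℝ :=
  harmonic k * N + X.cleanMarked * (1 - harmonic X.stale)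

lemma Valid.stale_le (h : X.Valid k) : X.stale ≤ k :=
  (Finset.card_le_card Finset.sdiff_subset).trans h.card_previous.le

lemma Valid.potential_le (h : X.Valid k) (N : ℝ) : X.potential k N ≤ harmonic k * N := by
  rw [potential, add_le_iff_nonpos_right]
  rcases Nat.eq_zero_or_pos X.cleanMarked with h_zero | h_pos
  · simp [h_zero]
  · have one_le : (1 : ℝ) ≤ harmonic X.stale := by
      exact_mod_cast one_le_harmonic (h_pos.trans_le (h.stale_eq ▸ Nat.le_add_left _ _))
    exact mul_nonpos_of_nonneg_of_nonpos (Nat.cast_nonneg _) (by linarith)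

lemma Valid.potential_next_of_stale (h : X.Valid k) (hi : i ∉ X.marked) (hX : X.marked.card ≠ k)
    (hi' : i ∈ X.previous) (N : ℝ) :
    (X.next k i).potential k (N + X.clean k i) = X.faultProb k i + X.potential k N := by
  have stale_insert : X.stale = stale ⟨insert i X.marked, X.previous⟩ + 1 := by
    rw [stale, stale, Finset.sdiff_insert,
      Finset.card_erase_add_one (Finset.mem_sdiff.2 ⟨hi', hi⟩)]
  have cleanMarked_insert : cleanMarked ⟨insert i X.marked, X.previous⟩ = X.cleanMarked := by
    rw [cleanMarked, cleanMarked, Finset.insert_sdiff_of_mem _ hi']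
  rw [h.faultProb_of_stale hi hi', next_of_card_ne hi hX, potential, potential, stale_insert,
    cleanMarked_insert, harmonic_succ, clean, if_neg hi, if_neg hX, if_pos hi']
  push_cast
  ring

lemma Valid.le_potential_next_of_new (h : X.Valid k) (hi : i ∉ X.marked) (hX : X.marked.card ≠ k)
    (hi' : i ∉ X.previous) (N : ℝ) :
    1 + X.potential k N ≤ (X.next k i).potential k (N + X.clean k i) := by
  have stale_insert : stale ⟨insert i X.marked, X.previous⟩ = X.stale := by
    rw [stale, stale, Finset.sdiff_insert, Finset.erase_eq_of_notMem (by simp [hi'])]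
  have cleanMarked_insert : cleanMarked ⟨insert i X.marked, X.previous⟩ = X.cleanMarked + 1 := by
    rw [cleanMarked, cleanMarked, Finset.insert_sdiff_of_notMem _ hi',
      Finset.card_insert_of_notMem (by simp [hi])]
  have harmonic_le : (harmonic X.stale : ℝ) ≤ harmonic k := by
    exact_mod_cast harmonic_mono h.stale_le
  rw [next_of_card_ne hi hX, potential, potential, stale_insert, cleanMarked_insert, clean,
    if_neg hi, if_neg hX, if_neg hi']
  push_cast
  linarith

lemma cleanMarked_singleton (hi : i ∉ X.marked) : cleanMarked ⟨{i}, X.marked⟩ = 1 := by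
  rw [cleanMarked, Finset.sdiff_eq_self_of_disjoint (Finset.disjoint_singleton_left.2 hi),
    Finset.card_singleton]

lemma Valid.le_potential_next_of_full (h : X.Valid k) (hi : i ∉ X.marked)
    (hX : X.marked.card = k) (N : ℝ) :
    1 + X.potential k N ≤ (X.next k i).potential k (N + X.clean k i) := by
  have stale_singleton : stale ⟨{i}, X.marked⟩ = k := by
    rw [stale, Finset.sdiff_singleton_eq_erase, Finset.erase_eq_of_notMem hi, hX]
  have potential_le := h.potential_le N
  rw [next_of_card_eq hi hX, potential.eq_def k ⟨{i}, _⟩, stale_singleton, cleanMarked_singleton hi,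
    clean, if_neg hi, if_pos hX, Nat.cast_one]
  linarith

lemma Valid.faultProb_add_potential_le (h : X.Valid k) (i : Fin n) (N : ℝ) :
    X.faultProb k i + X.potential k N ≤ (X.next k i).potential k (N + X.clean k i) := by
  by_cases hi : i ∈ X.marked
  · simp [faultProb_of_mem hi, next_of_mem hi, clean, hi]
  have fault_le := X.faultProb_le_one k i
  by_cases full : X.marked.card = k
  · linarith [h.le_potential_next_of_full hi full N]
  by_cases hi' : i ∈ X.previous
  · exact (h.potential_next_of_stale hi full hi' N).ge
  · linarith [h.le_potential_next_of_new hi full hi' N]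

end MarkState

/-- The state of the marking algorithm after the first `t` requests, with initial cache `C₀`. -/
def markState (C₀ : Cache n k) (r : ℕ → Fin n) : ℕ → MarkState n
  | 0 => ⟨∅, C₀.1⟩
  | t + 1 => (markState C₀ r t).next k (r (t + 1))

/-- The number of clean requests among the first `t`. -/
def cleanCount (C₀ : Cache n k) (r : ℕ → Fin n) : ℕ → ℝ
  | 0 => 0
  | t + 1 => cleanCount C₀ r t + (markState C₀ r t).clean k (r (t + 1))

lemma nonanticipating_markState (C₀ : Cache n k) : Nonanticipating (markState C₀) := by
  intro r r' t h
  induction t with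
  | zero => rfl
  | succ t ih =>
    rw [markState, markState, ih fun s hs hst => h s hs (by omega), h (t + 1) (by omega) le_rfl]

lemma markState_valid (hk : 1 ≤ k) (C₀ : Cache n k) (r : ℕ → Fin n) (t : ℕ) :
    (markState C₀ r t).Valid k := by
  induction t with
  | zero => exact ⟨Nat.zero_le k, C₀.2⟩
  | succ t ih => exact ih.next hk _

lemma sum_faultProb_le (hk : 1 ≤ k) (C₀ : Cache n k) (r : ℕ → Fin n) (m : ℕ) :
    ∑ t ∈ Finset.range m, (markState C₀ r t).faultProb k (r (t + 1)) ≤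
      harmonic k * cleanCount C₀ r m := by
  have sum_le_potential : ∑ t ∈ Finset.range m, (markState C₀ r t).faultProb k (r (t + 1)) ≤
      (markState C₀ r m).potential k (cleanCount C₀ r m) := by
    induction m with
    | zero => simp [markState, cleanCount, MarkState.potential, MarkState.cleanMarked]
    | succ m ih =>
      rw [Finset.sum_range_succ, markState, cleanCount]
      linarith [(markState_valid hk C₀ r m).faultProb_add_potential_le (r (m + 1))
        (cleanCount C₀ r m)]
  exact sum_le_potential.trans ((markState_valid hk C₀ r m).potential_le _)

lemma card_insert_union_sdiff_le (i : Fin n) (D : Finset (Fin n)) (C C' P : Cache n k) :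
    (((insert i D ∪ C'.1) \ P.1).card : ℝ) ≤
      ((D ∪ C.1) \ P.1).card + (missLoss i C' + moveCost C' C) := by
  have subset : (insert i D ∪ C'.1) \ P.1 ⊆
      ((D ∪ C.1) \ P.1) ∪ (({i} \ C'.1) ∪ (C'.1 \ C.1)) := by grind
  have card_le := (Finset.card_le_card subset).trans <| (Finset.card_union_le _ _).trans <|
    Nat.add_le_add_left (Finset.card_union_le _ _) _
  have miss_ge : ((({i} : Finset (Fin n)) \ C'.1).card : ℝ) ≤ missLoss i C' := by
    unfold missLoss
    split_ifs with h
    · simp [h]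
    · exact_mod_cast (Finset.card_le_card Finset.sdiff_subset).trans (by simp)
  rw [← Nat.cast_le (α := ℝ)] at card_le
  push_cast at card_le
  unfold moveCost
  linarith

/-- The comparison of the number `N` of clean requests with the cost `O` of an offline player, who
is now in the cache `C`. Here `y` and `x` are the costs of this player up to the start of the
previous and of the current phase; since then, the player has paid for every requested page which
was not in the cache at that time. -/
structure CleanBound (X : MarkState n) (C : Cache n k) (N O y x : ℝ) : Prop where
  clean_le : N ≤ X.cleanMarked + x + y + k
  since_previous : ∃ P : Cache n k, ((X.previous ∪ X.marked ∪ C.1) \ P.1).card + y ≤ O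
  since_current : ∃ P : Cache n k, ((X.marked ∪ C.1) \ P.1).card + x ≤ O

namespace CleanBound

variable {X : MarkState n} {C : Cache n k} {N O y x : ℝ}

lemma init (C₀ C : Cache n k) : CleanBound ⟨∅, C₀.1⟩ C 0 0 (-k) 0 where
  clean_le := by simp
  since_previous := by
    refine ⟨C, ?_⟩
    rw [Finset.union_empty, Finset.union_sdiff_right]
    have := (Finset.card_le_card (Finset.sdiff_subset (s := C₀.1) (t := C.1))).trans C₀.2.le
    rw [← Nat.cast_le (α := ℝ)] at this
    linarith
  since_current := ⟨C, by simp⟩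

lemma cleanMarked_add_le (h : CleanBound X C N O y x) (hX : X.Valid k) :
    X.cleanMarked + y ≤ O := by
  obtain ⟨P, hP⟩ := h.since_previous
  have cleanMarked_le : X.cleanMarked ≤ ((X.previous ∪ X.marked ∪ C.1) \ P.1).card := by
    have union_eq := Finset.card_sdiff_add_card X.marked X.previous
    have sdiff_ge := Finset.le_card_sdiff P.1 (X.previous ∪ X.marked)
    have sdiff_le := Finset.card_le_card (Finset.sdiff_subset_sdiff
      (Finset.subset_union_left (s₁ := X.previous ∪ X.marked) (s₂ := C.1)) (subset_refl P.1))
    rw [Finset.union_comm, hX.card_previous] at union_eq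
    rw [P.2] at sdiff_ge
    rw [MarkState.cleanMarked]
    omega
  rw [← Nat.cast_le (α := ℝ)] at cleanMarked_le
  linarith

lemma le (h : CleanBound X C N O y x) (hX : X.Valid k) : N ≤ 2 * O + k := by
  obtain ⟨P, hP⟩ := h.since_current
  linarith [h.clean_le, h.cleanMarked_add_le hX,
    Nat.cast_nonneg (α := ℝ) ((X.marked ∪ C.1) \ P.1).card]

lemma next_of_full (h : CleanBound X C N O y x) (hX : X.Valid k) {i : Fin n} (hi : i ∉ X.marked)
    (full : X.marked.card = k) (C' : Cache n k) :
    CleanBound (X.next k i) C' (N + X.clean k i) (O + (missLoss i C' + moveCost C' C)) x O where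
  clean_le := by
    rw [MarkState.next_of_card_eq hi full, MarkState.clean, if_neg hi, if_pos full,
      MarkState.cleanMarked_singleton hi]
    push_cast
    linarith [h.clean_le, h.cleanMarked_add_le hX]
  since_previous := by
    obtain ⟨P, hP⟩ := h.since_current
    refine ⟨P, ?_⟩
    rw [MarkState.next_of_card_eq hi full, Finset.union_comm X.marked, ← Finset.insert_eq]
    linarith [card_insert_union_sdiff_le i X.marked C C' P]
  since_current := by
    refine ⟨C', ?_⟩
    have := card_insert_union_sdiff_le i ∅ C' C' C'
    rw [MarkState.next_of_card_eq hi full]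
    simp only [Finset.empty_union, Finset.sdiff_self, Finset.card_empty, moveCost_self,
      insert_empty_eq, Nat.cast_zero] at this
    linarith [moveCost_nonneg C' C]

lemma next_of_not_full (h : CleanBound X C N O y x) {i : Fin n}
    (hi : i ∈ X.marked ∨ X.marked.card ≠ k) (C' : Cache n k) :
    CleanBound (X.next k i) C' (N + X.clean k i) (O + (missLoss i C' + moveCost C' C)) y x := by
  have next_eq : X.next k i = ⟨insert i X.marked, X.previous⟩ := by
    by_cases hi' : i ∈ X.marked
    · rw [MarkState.next_of_mem hi', Finset.insert_eq_of_mem hi']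
    · exact MarkState.next_of_card_ne hi' (hi.resolve_left hi')
  have cleanMarked_eq : ((X.next k i).cleanMarked : ℝ) = X.cleanMarked + X.clean k i := by
    rw [next_eq, MarkState.cleanMarked, MarkState.cleanMarked, MarkState.clean]
    split_ifs with h_marked h_full h_previous
    · simp [h_marked]
    · exact absurd h_full (hi.resolve_left h_marked)
    · simp [Finset.insert_sdiff_of_mem, h_previous]
    · rw [Finset.insert_sdiff_of_notMem _ h_previous, Finset.card_insert_of_notMem (by
        simp [h_marked]), Nat.cast_succ]
  obtain ⟨P, hP⟩ := h.since_previous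
  obtain ⟨Q, hQ⟩ := h.since_current
  refine ⟨by linarith [h.clean_le], ⟨P, ?_⟩, ⟨Q, ?_⟩⟩
  · rw [next_eq, Finset.union_insert]
    linarith [card_insert_union_sdiff_le i (X.previous ∪ X.marked) C C' P]
  · rw [next_eq]
    linarith [card_insert_union_sdiff_le i X.marked C C' Q]

end CleanBound

lemma cost_zero_succ (r : ℕ → Fin n) (S : ℕ → Cache n k) (t : ℕ) :
    cost r S 0 (t + 1) =
      cost r S 0 t + (missLoss (r (t + 1)) (S (t + 1)) + moveCost (S (t + 1)) (S (max t 1))) := by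
  cases t with
  | zero => simp [cost, moveCost_self]
  | succ t =>
    rw [cost_succ_eq, cost_succ_eq, ← add_assoc, Finset.sum_Ioc_succ_top (by omega), transitionCost,
      zero_add, max_eq_left (by omega)]
    ring

lemma cleanCount_le (hk : 1 ≤ k) (C₀ : Cache n k) (r : ℕ → Fin n) (S : ℕ → Cache n k) (t : ℕ) :
    cleanCount C₀ r t ≤ 2 * cost r S 0 t + k := by
  have invariant : ∃ y x, CleanBound (markState C₀ r t) (S (max t 1)) (cleanCount C₀ r t)
      (cost r S 0 t) y x := by
    induction t with
    | zero => exact ⟨-k, 0, by simpa [cost, markState, cleanCount] using CleanBound.init C₀ (S 1)⟩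
    | succ t ih =>
      obtain ⟨y, x, h⟩ := ih
      rw [cost_zero_succ, max_eq_left (Nat.le_add_left 1 t)]
      by_cases phase_start : r (t + 1) ∉ (markState C₀ r t).marked ∧
          (markState C₀ r t).marked.card = k
      · exact ⟨x, _, h.next_of_full (markState_valid hk C₀ r t) phase_start.1 phase_start.2 _⟩
      · exact ⟨y, x, h.next_of_not_full (by tauto) _⟩
  obtain ⟨y, x, h⟩ := invariant
  exact h.le (markState_valid hk C₀ r t)

/-- Permutations of the pages form a finite set, hence a discrete measurable space. -/
instance : MeasurableSpace (Equiv.Perm (Fin n)) := ⊤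

instance : DiscreteMeasurableSpace (Equiv.Perm (Fin n)) := ⟨fun _ => trivial⟩

/-- The cache of the marking algorithm at time `t`, for the random order `σ` of the pages. -/
def markingCache (hk : 1 ≤ k) (C₀ : Cache n k) (r : ℕ → Fin n) (t : ℕ)
    (σ : Equiv.Perm (Fin n)) : Cache n k :=
  ⟨(markState C₀ r t).cacheSet k σ, (markState_valid hk C₀ r t).card_cacheSet σ⟩

/-- The marking algorithm with a random priority order of the pages. Once this order is drawn, the
cache is a function of the requests. -/
noncomputable def marking (hk : 1 ≤ k) (C₀ : Cache n k) : Algorithm n k where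
  Ω := Equiv.Perm (Fin n)
  μ := (PMF.uniformOfFintype (Equiv.Perm (Fin n))).toMeasure
  act := onHistory (fun _ => C₀) (markingCache hk C₀)
  measurable_act _ _ := MeasurableSet.of_discrete

lemma marking_run (hk : 1 ≤ k) (C₀ : Cache n k) (r : ℕ → Fin n) (σ : Equiv.Perm (Fin n)) (t : ℕ) :
    (marking hk C₀).run r σ t = markingCache hk C₀ r t σ := by
  have : Nonanticipating (markingCache hk C₀) := fun r r' t h => by
    funext σ
    simp only [markingCache, nonanticipating_markState C₀ h]
  exact congrFun (this.onHistory_history _ r t) σ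

lemma transitionCost_markingCache_le (hk : 1 ≤ k) (C₀ : Cache n k) (r : ℕ → Fin n)
    (σ : Equiv.Perm (Fin n)) (t : ℕ) :
    transitionCost (r (t + 1)) (markingCache hk C₀ r (t + 1) σ)
        (markingCache hk C₀ r (t + 2) σ) ≤
      if r (t + 2) ∈ (markState C₀ r (t + 1)).cacheSet k σ then 0 else 1 := by
  have hit : missLoss (r (t + 1)) (markingCache hk C₀ r (t + 1) σ) = 0 :=
    if_pos (Finset.mem_union_left _ (MarkState.mem_marked_next k _ _))
  have next_subset := (markState_valid hk C₀ r (t + 1)).cacheSet_next_subset (r (t + 2)) σ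
  rw [transitionCost, hit, zero_add, moveCost]
  split_ifs with h
  · rw [Finset.insert_eq_of_mem h] at next_subset
    exact_mod_cast (Finset.card_eq_zero.2 (Finset.sdiff_eq_empty_iff_subset.2 next_subset)).le
  · have fetched_subset : (markingCache hk C₀ r (t + 2) σ).1 \ (markingCache hk C₀ r (t + 1) σ).1 ⊆
        {r (t + 2)} := by
      rw [Finset.insert_eq, Finset.union_comm] at next_subset
      exact sdiff_le_iff.2 next_subset
    exact_mod_cast (Finset.card_le_card fetched_subset).trans_eq (Finset.card_singleton _)

lemma stepCost_marking_le (hk : 1 ≤ k) (C₀ : Cache n k) (r : ℕ → Fin n) (t : ℕ) :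
    (marking hk C₀).stepCost r (t + 1) ≤ (markState C₀ r (t + 1)).faultProb k (r (t + 2)) := by
  have stepCost_eq : (marking hk C₀).stepCost r (t + 1) =
      ∑ σ, (Fintype.card (Equiv.Perm (Fin n)) : ℝ)⁻¹ * transitionCost (r (t + 1))
        (markingCache hk C₀ r (t + 1) σ) (markingCache hk C₀ r (t + 2) σ) := by
    refine (PMF.integral_eq_sum (PMF.uniformOfFintype (Equiv.Perm (Fin n))) _).trans ?_
    refine Finset.sum_congr rfl fun σ _ => ?_
    rw [marking_run, marking_run]
    simp
  rw [stepCost_eq, MarkState.faultProb, ← Finset.mul_sum, div_eq_inv_mul, ← Finset.sum_boole]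
  gcongr with σ
  simpa only [ite_not] using transitionCost_markingCache_le hk C₀ r σ t

lemma sum_stepCost_marking_le (hk : 1 ≤ k) (C₀ : Cache n k) (r : ℕ → Fin n) (S : ℕ → Cache n k)
    (m : ℕ) :
    ∑ t ∈ Finset.Ioc 0 m, (marking hk C₀).stepCost r t ≤
      2 * harmonic k * cost r S 0 m + harmonic k * (k + 1) := by
  have harmonic_nonneg : (0 : ℝ) ≤ harmonic k := by
    exact_mod_cast zero_le_one.trans (one_le_harmonic hk)
  calc ∑ t ∈ Finset.Ioc 0 m, (marking hk C₀).stepCost r t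
      = ∑ t ∈ Finset.range m, (marking hk C₀).stepCost r (t + 1) := by
        rw [Finset.range_eq_Ico, Finset.sum_Ico_add', Finset.Ico_add_one_add_one_eq_Ioc]
    _ ≤ ∑ t ∈ Finset.range m, (markState C₀ r (t + 1)).faultProb k (r (t + 2)) :=
        Finset.sum_le_sum fun t _ => stepCost_marking_le hk C₀ r t
    _ ≤ ∑ t ∈ Finset.range (m + 1), (markState C₀ r t).faultProb k (r (t + 1)) := by
        rw [Finset.sum_range_succ']
        exact le_add_of_nonneg_right (MarkState.faultProb_nonneg k _ _)
    _ ≤ harmonic k * cleanCount C₀ r (m + 1) := sum_faultProb_le hk C₀ r (m + 1)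
    _ ≤ harmonic k * (2 * cost r S 0 m + k + 1) := by
        gcongr
        exact add_le_add (cleanCount_le hk C₀ r S m) (MarkState.clean_le_one k _ _)
    _ = 2 * harmonic k * cost r S 0 m + harmonic k * (k + 1) := by ring

section Dyadic

/-- The `s`-th of the consecutive disjoint intervals of length `2 ^ j`, which are the blocks on
which an algorithm of scale `j` restarts. -/
def dyadicBlock (j s : ℕ) : Finset ℕ := Finset.Ioc (s * 2 ^ j) (s * 2 ^ j + 2 ^ j)

lemma four_sqrt_two_pow_add_le (j : ℕ) :
    4 * √(2 ^ j) + √(2 ^ (j + 1)) ≤ 4 * √(2 ^ (j + 1)) := by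
  have four_le_three_sqrt_two : 4 ≤ 3 * √2 := by
    rw [← div_le_iff₀' three_pos]
    exact Real.le_sqrt_of_sq_le (by norm_num)
  rw [pow_succ, Real.sqrt_mul' _ zero_le_two]
  linarith [mul_le_mul_of_nonneg_right four_le_three_sqrt_two (Real.sqrt_nonneg (2 ^ j))]

variable {f : ℕ → ℝ} {ρ : ℝ} {T : ℕ}

lemma sum_Ioc_right_le (hρ : 0 ≤ ρ)
    (hf : ∀ j s, 2 ^ j ≤ T → ∑ t ∈ dyadicBlock j s, f t ≤ ρ * √(2 ^ j)) {j a m : ℕ}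
    (ha : 2 ^ j ∣ a) (hm : m < 2 ^ (j + 1)) (hT : m ≤ T) :
    ∑ t ∈ Finset.Ioc a (a + m), f t ≤ ρ * (4 * √(2 ^ j)) := by
  induction j generalizing a m with
  | zero =>
    obtain rfl | rfl : m = 0 ∨ m = 1 := by omega
    · simp [hρ]
    · have unit_block := hf 0 a hT
      rw [pow_zero, Real.sqrt_one] at unit_block ⊢
      simp only [dyadicBlock, pow_zero, mul_one] at unit_block
      linarith
  | succ j ih =>
    have dvd_succ : 2 ^ j ∣ 2 ^ (j + 1) := pow_dvd_pow 2 j.le_succ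
    have geometric := mul_le_mul_of_nonneg_left (four_sqrt_two_pow_add_le j) hρ
    have : 0 ≤ ρ * √(2 ^ (j + 1)) := by positivity
    rcases lt_or_ge m (2 ^ (j + 1)) with short | long
    · linarith [ih (dvd_succ.trans ha) short hT]
    · obtain ⟨m, rfl⟩ := Nat.exists_eq_add_of_le long
      have rest := ih (a := a + 2 ^ (j + 1)) (m := m) ((dvd_succ.trans ha).add dvd_succ)
        (by rw [pow_succ] at hm; omega) (by omega)
      obtain ⟨s, rfl⟩ := ha
      have first_block := hf (j + 1) s (long.trans hT)
      rw [dyadicBlock, mul_comm s] at first_block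
      rw [← Finset.sum_Ioc_consecutive f (Nat.le_add_right _ (2 ^ (j + 1))) (by omega),
        ← add_assoc]
      linarith

lemma sum_Ioc_left_le (hρ : 0 ≤ ρ)
    (hf : ∀ j s, 2 ^ j ≤ T → ∑ t ∈ dyadicBlock j s, f t ≤ ρ * √(2 ^ j)) {j a m : ℕ}
    (ha : 2 ^ j ∣ a + m) (hm : m < 2 ^ (j + 1)) (hT : m ≤ T) :
    ∑ t ∈ Finset.Ioc a (a + m), f t ≤ ρ * (4 * √(2 ^ j)) := by
  induction j generalizing m with
  | zero => exact sum_Ioc_right_le hρ hf (by simp) hm hT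
  | succ j ih =>
    have dvd_succ : 2 ^ j ∣ 2 ^ (j + 1) := pow_dvd_pow 2 j.le_succ
    have geometric := mul_le_mul_of_nonneg_left (four_sqrt_two_pow_add_le j) hρ
    have : 0 ≤ ρ * √(2 ^ (j + 1)) := by positivity
    rcases lt_or_ge m (2 ^ (j + 1)) with short | long
    · linarith [ih (dvd_succ.trans ha) short hT]
    · obtain ⟨m, rfl⟩ := Nat.exists_eq_add_of_le' long
      rw [← add_assoc, Nat.dvd_add_self_right] at ha
      have rest := ih (dvd_succ.trans ha) (by rw [pow_succ] at hm; omega) (by omega)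
      obtain ⟨s, hs⟩ := ha
      have last_block := hf (j + 1) s (long.trans hT)
      rw [dyadicBlock, mul_comm s, ← hs] at last_block
      rw [← add_assoc, ← Finset.sum_Ioc_consecutive f (Nat.le_add_right a m) (by omega)]
      linarith

lemma sum_Ioc_le_of_dyadicBlock (hρ : 0 ≤ ρ)
    (hf : ∀ j s, 2 ^ j ≤ T → ∑ t ∈ dyadicBlock j s, f t ≤ ρ * √(2 ^ j)) {t₀ m : ℕ} (hm : 1 ≤ m)
    (hT : m ≤ T) : ∑ t ∈ Finset.Ioc t₀ (t₀ + m), f t ≤ 8 * ρ * √m := by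
  obtain ⟨j, pow_le, lt_pow_succ⟩ : ∃ j, 2 ^ j ≤ m ∧ m < 2 ^ (j + 1) :=
    ⟨Nat.log 2 m, Nat.pow_log_le_self 2 (by omega), Nat.lt_pow_succ_log_self one_lt_two m⟩
  obtain ⟨a, b, rfl, dvd_split, b_lt⟩ : ∃ a b, m = a + b ∧ 2 ^ j ∣ t₀ + a ∧ b < 2 ^ j := by
    have remainder_lt := Nat.mod_lt (t₀ + m) (show 0 < 2 ^ j by positivity)
    refine ⟨m - (t₀ + m) % 2 ^ j, (t₀ + m) % 2 ^ j, by omega, ?_, remainder_lt⟩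
    rw [← Nat.add_sub_assoc (by omega)]
    exact Nat.dvd_sub_mod _
  have left := sum_Ioc_left_le hρ hf dvd_split (by omega) (by omega)
  have right := sum_Ioc_right_le hρ hf dvd_split
    (b_lt.trans (Nat.pow_lt_pow_succ one_lt_two)) (by omega)
  have : √(2 ^ j) ≤ √(a + b : ℕ) := Real.sqrt_le_sqrt (by exact_mod_cast pow_le)
  have := mul_le_mul_of_nonneg_left this hρ
  rw [← Finset.sum_Ioc_consecutive f (Nat.le_add_right t₀ a) (by omega), ← add_assoc]
  linarith

end Dyadic

/-- The regret on dyadic blocks of length `2 ^ j` of an algorithm for horizon `T` that combines all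
scales: `10 * √(k * 2 ^ j * log (n.choose k))` is the regret of multiplicative weights, the rest is
lost in the combination. -/
noncomputable def blockRegret (n k T j : ℕ) : ℝ :=
  10 * √(k * 2 ^ j * Real.log (n.choose k)) + 30 * k * √(2 ^ j * Real.log T) + 7 * k

lemma card_cache (n k : ℕ) : Fintype.card (Cache n k) = n.choose k := by
  rw [Fintype.card_finset_len, Fintype.card_fin]

lemma half_le_log {T : ℕ} (hT : 2 ≤ T) : 1 / 2 ≤ Real.log T := by
  have : Real.log 2 ≤ Real.log T := Real.log_le_log two_pos (by exact_mod_cast hT)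
  linarith [Real.log_two_gt_d9]

lemma sum_stepCost_le_blockRegret (hk : 1 ≤ k) {T j : ℕ} (hj : 2 ^ j ≤ 16 * Real.log T)
    (A : Algorithm n k) (r : ℕ → Fin n) (s : ℕ) :
    ∑ t ∈ dyadicBlock j s, A.stepCost r t ≤ blockRegret n k T j := by
  have one_le_k : (1 : ℝ) ≤ k := by exact_mod_cast hk
  have two_pow_le : (2 : ℝ) ^ j ≤ 4 * √(2 ^ j * Real.log T) := by
    rw [← div_le_iff₀' four_pos]
    refine Real.le_sqrt_of_sq_le ?_
    nlinarith [pow_pos (two_pos (α := ℝ)) j]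
  calc ∑ t ∈ dyadicBlock j s, A.stepCost r t
      ≤ ∑ _t ∈ dyadicBlock j s, (2 + k : ℝ) := Finset.sum_le_sum fun t _ => A.stepCost_le r t
    _ = 2 ^ j * (2 + k) := by
        rw [Finset.sum_const, dyadicBlock, Nat.card_Ioc, Nat.add_sub_cancel_left, nsmul_eq_mul,
          Nat.cast_pow, Nat.cast_ofNat]
    _ ≤ 4 * √(2 ^ j * Real.log T) * (3 * k) :=
        mul_le_mul two_pow_le (by linarith) (by positivity) (by positivity)
    _ ≤ blockRegret n k T j := by
        have : 0 ≤ √(k * 2 ^ j * Real.log (n.choose k)) := Real.sqrt_nonneg _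
        have : 0 ≤ k * √(2 ^ j * Real.log T) := by positivity
        unfold blockRegret
        linarith

section Tuning

variable {T j : ℕ}

lemma inv_le_learningRate (hT : 2 ≤ T) (hj : 2 ^ j ≤ T) :
    (T : ℝ)⁻¹ ≤ √(Real.log T / 2 ^ j) := by
  have two_le_T : (2 : ℝ) ≤ T := by exact_mod_cast hT
  have two_pow_le_T : (2 : ℝ) ^ j ≤ T := by exact_mod_cast hj
  refine Real.le_sqrt_of_sq_le ?_
  have log_pos : 0 < Real.log T := by linarith [half_le_log hT]
  rw [inv_pow, inv_le_comm₀ (by positivity) (by positivity), inv_div, div_le_iff₀ (by positivity)]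
  nlinarith [half_le_log hT]

lemma learningRate_le (hj : 16 * Real.log T ≤ 2 ^ j) : √(Real.log T / 2 ^ j) ≤ 1 / 4 := by
  rw [Real.sqrt_le_left (by norm_num), div_le_iff₀ (by positivity)]
  linarith

lemma inv_pow_four_div_le {T η : ℝ} (hT : 0 < T) (hη : T⁻¹ ≤ η) : (T ^ 4)⁻¹ / η ≤ (T ^ 3)⁻¹ := by
  rw [div_le_iff₀ ((inv_pos.2 hT).trans_le hη)]
  calc (T ^ 4)⁻¹ = (T ^ 3)⁻¹ * T⁻¹ := by rw [← mul_inv, ← pow_succ]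
    _ ≤ _ := by gcongr

lemma default_loss_le {T η m : ℝ} (hT : 1 ≤ T) (hη : T⁻¹ ≤ η) (hm : m ≤ T) :
    (m + 1) * ((T ^ 4)⁻¹ / η + (T ^ 4)⁻¹) ≤ 4 / T ^ 2 := by
  have hT₀ : 0 < T := by linarith
  have η_pos : 0 < η := (inv_pos.2 hT₀).trans_le hη
  have div_rate_le := inv_pow_four_div_le hT₀ hη
  have inv_pow_le : (T ^ 4)⁻¹ ≤ (T ^ 3)⁻¹ :=
    inv_anti₀ (by positivity) (pow_le_pow_right₀ hT (by norm_num))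
  calc (m + 1) * ((T ^ 4)⁻¹ / η + (T ^ 4)⁻¹) ≤ (2 * T) * (2 * (T ^ 3)⁻¹) :=
        mul_le_mul (by linarith) (by linarith) (by positivity) (by positivity)
    _ = 4 / T ^ 2 := by field_simp; norm_num

lemma expert_loss_le (hT : 2 ≤ T) (hjT : 2 ^ j ≤ T) {η Z : ℝ}
    (hη : η = √(Real.log T / 2 ^ j)) (hZ : Z = ((T : ℝ) ^ 4)⁻¹) :
    -Real.log Z / η + 6 * η * 2 ^ j + Z / η + 1 ≤ 10 * √(2 ^ j * Real.log T) + 2 := by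
  have log_nonneg : 0 ≤ Real.log T := Real.log_natCast_nonneg T
  have one_le_T : (1 : ℝ) ≤ T := by exact_mod_cast one_le_two.trans hT
  have log_Z : -Real.log Z = 4 * Real.log T := by
    rw [hZ, Real.log_inv, Real.log_pow, neg_neg, Nat.cast_ofNat]
  have Z_div_le : Z / η ≤ 1 := by
    rw [hZ, hη]
    exact (inv_pow_four_div_le (by linarith) (inv_le_learningRate hT hjT)).trans
      (inv_le_one_of_one_le₀ (one_le_pow₀ one_le_T))
  have two_pow_nonneg : (0 : ℝ) ≤ 2 ^ j := by positivity
  rw [log_Z, mul_div_assoc, mul_assoc, hη, div_sqrt_div log_nonneg two_pow_nonneg,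
    sqrt_div_mul log_nonneg two_pow_nonneg, ← hη]
  linarith

end Tuning

lemma exists_improvement (hk : 1 ≤ k) (hN : 2 ≤ n.choose k) {T : ℕ} (hT : 2 ≤ T) {j : ℕ}
    (hj : 2 ^ j ≤ T) (A : Algorithm n k) :
    ∃ X : Algorithm n k, ∀ (r : ℕ → Fin n) (s : ℕ),
      (∀ m ≤ T, ∑ t ∈ Finset.Ioc (s * 2 ^ j) (s * 2 ^ j + m), X.stepCost r t ≤
        ∑ t ∈ Finset.Ioc (s * 2 ^ j) (s * 2 ^ j + m), A.stepCost r t + 12 * k / T ^ 2) ∧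
      ∀ C : Cache n k, ∑ t ∈ dyadicBlock j s, X.stepCost r t ≤
        ∑ t ∈ dyadicBlock j s, missLoss (r t) C + blockRegret n k T j := by
  rcases le_total (2 ^ j) (16 * Real.log T) with short | long
  · refine ⟨A, fun r s => ⟨fun m _ => le_add_of_nonneg_right (by positivity), fun C => ?_⟩⟩
    exact (sum_stepCost_le_blockRegret hk short A r s).trans
      (le_add_of_nonneg_left (Finset.sum_nonneg fun _ _ => missLoss_nonneg _ _))
  · set η := √(Real.log T / 2 ^ j) with hη
    set Z : ℝ := ((T : ℝ) ^ 4)⁻¹ with hZ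
    have T_pos : (0 : ℝ) < T := by positivity
    have inv_le_η := inv_le_learningRate hT hj
    have η_pos : 0 < η := (inv_pos.2 T_pos).trans_le inv_le_η
    have Z_pos : 0 < Z := by positivity
    obtain ⟨B, hB⟩ := exists_block_expert (n := n) hk (by rwa [card_cache])
      (Nat.one_le_two_pow (n := j))
    refine ⟨combine A B (2 ^ j) η Z, fun r s => ⟨fun m hm => ?_, fun C => ?_⟩⟩
    · have := default_loss_le (by exact_mod_cast one_le_two.trans hT) inv_le_η (m := m)
        (by exact_mod_cast hm)
      calc _ ≤ _ := sum_stepCost_combine_le_default hk A B η_pos (learningRate_le long) Z_pos r s m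
        _ ≤ _ + 3 * k * (4 / T ^ 2) := by gcongr
        _ = _ := by ring
    · have combine_le := sum_stepCost_combine_le_expert hk A B (τ := 2 ^ j) η_pos
        (learningRate_le long) Z_pos r s
      have expert_le := hB r s C
      rw [card_cache] at expert_le
      push_cast at combine_le expert_le
      have := mul_le_mul_of_nonneg_left (expert_loss_le hT hj hη hZ)
        (show 0 ≤ 3 * (k : ℝ) by positivity)
      unfold blockRegret dyadicBlock
      linarith

lemma exists_chain (hk : 1 ≤ k) (hN : 2 ≤ n.choose k) {T J : ℕ} (hT : 2 ≤ T) (hJ : 2 ^ J ≤ T)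
    (A : Algorithm n k) {i : ℕ} (hi : i ≤ J + 1) :
    ∃ X : Algorithm n k, ∀ r : ℕ → Fin n,
      ∑ t ∈ Finset.Ioc 0 T, X.stepCost r t ≤
        ∑ t ∈ Finset.Ioc 0 T, A.stepCost r t + i * (12 * k / T ^ 2) ∧
      ∀ j, J < j + i → j ≤ J → ∀ (s : ℕ) (C : Cache n k),
        ∑ t ∈ dyadicBlock j s, X.stepCost r t ≤ ∑ t ∈ dyadicBlock j s, missLoss (r t) C +
          blockRegret n k T j + i * (12 * k / T ^ 2) := by
  induction i with
  | zero => exact ⟨A, fun r => ⟨by simp, fun j hj hjJ => by omega⟩⟩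
  | succ i ih =>
    obtain ⟨X, hX⟩ := ih (by omega)
    obtain ⟨Y, hY⟩ := exists_improvement hk hN hT (j := J - i)
      ((Nat.pow_le_pow_right two_pos (J.sub_le i)).trans hJ) X
    have : (0 : ℝ) ≤ i * (12 * k / T ^ 2) := by positivity
    have : (0 : ℝ) ≤ 12 * k / T ^ 2 := by positivity
    refine ⟨Y, fun r => ⟨?_, fun j hj hjJ s C => ?_⟩⟩
    · have default_loss := (hY r 0).1 T le_rfl
      simp only [zero_mul, zero_add] at default_loss
      push_cast
      linarith [(hX r).1]
    · rw [Nat.cast_succ, add_one_mul]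
      rcases lt_or_ge J (j + i) with coarse | new
      · have default_loss := (hY r (s * 2 ^ (j - (J - i)))).1 (2 ^ j)
          ((Nat.pow_le_pow_right two_pos hjJ).trans hJ)
        rw [mul_assoc, ← pow_add, Nat.sub_add_cancel (by omega), ← dyadicBlock] at default_loss
        linarith [(hX r).2 j coarse hjJ s C]
      · obtain rfl : j = J - i := by omega
        linarith [(hY r s).2 C]

lemma exists_multiscale (hk : 1 ≤ k) (hN : 2 ≤ n.choose k) {T : ℕ} (hT : 2 ≤ T)
    (A : Algorithm n k) :
    ∃ X : Algorithm n k, ∀ r : ℕ → Fin n,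
      ∑ t ∈ Finset.Ioc 0 T, X.stepCost r t ≤ ∑ t ∈ Finset.Ioc 0 T, A.stepCost r t + 12 * k ∧
      ∀ (j s : ℕ) (C : Cache n k), 2 ^ j ≤ T →
        ∑ t ∈ dyadicBlock j s, (X.stepCost r t - missLoss (r t) C) ≤
          blockRegret n k T j + 12 * k := by
  set J := Nat.log 2 T
  have two_pow_le : 2 ^ J ≤ T := Nat.pow_log_le_self 2 (by omega)
  have scales_loss : ((J + 1 : ℕ) : ℝ) * (12 * k / T ^ 2) ≤ 12 * k := by
    have scales_le : ((J + 1 : ℕ) : ℝ) ≤ T ^ 2 := by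
      exact_mod_cast (Nat.lt_two_pow_self.trans_le two_pow_le).trans_le (Nat.le_pow two_pos)
    rw [mul_div_left_comm]
    exact mul_le_of_le_one_right (by positivity) (div_le_one_of_le₀ scales_le (by positivity))
  obtain ⟨X, hX⟩ := exists_chain hk hN hT two_pow_le A le_rfl
  refine ⟨X, fun r => ⟨by linarith [(hX r).1], fun j s C hj => ?_⟩⟩
  rw [Finset.sum_sub_distrib]
  linarith [(hX r).2 j (by omega) (Nat.le_log_of_pow_le one_lt_two hj) s C]

lemma blockRegret_add_le {T : ℕ} (hT : 2 ≤ T) (j : ℕ) :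
    blockRegret n k T j + 12 * k ≤
      70 * (k * √(Real.log T) + √(k * Real.log (n.choose k))) * √(2 ^ j) := by
  have expert_term :
      √(k * 2 ^ j * Real.log (n.choose k)) = √(k * Real.log (n.choose k)) * √(2 ^ j) := by
    rw [← Real.sqrt_mul' _ (by positivity), mul_right_comm]
  have combination_term : √(2 ^ j * Real.log T) = √(Real.log T) * √(2 ^ j) := by
    rw [← Real.sqrt_mul' _ (by positivity), mul_comm]
  have constant_term : k * (1 / 2 * 1) ≤ k * (√(Real.log T) * √(2 ^ j)) := by
    gcongr
    · exact Real.le_sqrt_of_sq_le (by linarith [half_le_log hT])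
    · exact Real.one_le_sqrt.2 (one_le_pow₀ one_le_two)
  have : 0 ≤ √(k * Real.log (n.choose k)) * √(2 ^ j) := by positivity
  rw [blockRegret, expert_term, combination_term]
  linarith

/-- The regret bound of the theorem on intervals of length `m`, up to a constant factor. -/
noncomputable def intervalRegret (n k T m : ℕ) : ℝ :=
  (k : ℝ) * √((m : ℝ) * Real.log (T : ℝ)) +
    √((k : ℝ) * (m : ℝ) * Real.log ((n.choose k : ℝ) * (T : ℝ)))

lemma intervalRegret_nonneg (n k T m : ℕ) : 0 ≤ intervalRegret n k T m := by
  unfold intervalRegret; positivity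

lemma mul_sqrt_le_intervalRegret (hkn : k ≤ n) {T : ℕ} (hT : 1 ≤ T) (m : ℕ) :
    (k * √(Real.log T) + √(k * Real.log (n.choose k))) * √m ≤ intervalRegret n k T m := by
  have choose_pos : (0 : ℝ) < n.choose k := by exact_mod_cast Nat.choose_pos hkn
  have log_choose_le : Real.log (n.choose k) ≤ Real.log (n.choose k * T) :=
    Real.log_le_log choose_pos (le_mul_of_one_le_right choose_pos.le (by exact_mod_cast hT))
  rw [intervalRegret, add_mul, mul_assoc, ← Real.sqrt_mul' _ m.cast_nonneg,
    ← Real.sqrt_mul' _ m.cast_nonneg, mul_comm (Real.log T), mul_right_comm]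
  gcongr

lemma intervalRegret_le (hk : 1 ≤ k) (hkn : k ≤ n) {T : ℕ} (hT : 1 ≤ T) (m : ℕ) :
    intervalRegret n k T m ≤ 2 * (k * √(m * Real.log (n * T))) := by
  have one_le_n : (1 : ℝ) ≤ n := by exact_mod_cast hk.trans hkn
  have one_le_T : (1 : ℝ) ≤ T := by exact_mod_cast hT
  have choose_pos : (0 : ℝ) < n.choose k := by exact_mod_cast Nat.choose_pos hkn
  have log_T_le : Real.log T ≤ Real.log (n * T) :=
    Real.log_le_log (by positivity) (le_mul_of_one_le_left (by positivity) one_le_n)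
  have log_choose_mul_le : Real.log (n.choose k * T) ≤ k * Real.log (n * T) := by
    rw [← Real.log_pow, mul_pow]
    refine Real.log_le_log (by positivity) ?_
    gcongr
    · exact_mod_cast Nat.choose_le_pow n k
    · exact le_self_pow₀ one_le_T (by omega)
  calc intervalRegret n k T m
      ≤ k * √(m * Real.log (n * T)) + √(k * m * (k * Real.log (n * T))) := by
        unfold intervalRegret; gcongr
    _ = k * √(m * Real.log (n * T)) + √(k ^ 2 * (m * Real.log (n * T))) := by ring_nf
    _ = 2 * (k * √(m * Real.log (n * T))) := by
        rw [Real.sqrt_mul (sq_nonneg _), Real.sqrt_sq k.cast_nonneg, ← two_mul]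

namespace Algorithm

lemma HasRegretBound.of_sum_stepCost_sub_le {A : Algorithm n k} {t₀ m : ℕ} {R : ℝ}
    (h : ∀ (r : ℕ → Fin n) (C : Cache n k),
      ∑ t ∈ Finset.Ioc t₀ (t₀ + m), (A.stepCost r t - missLoss (r t) C) ≤ R) :
    A.HasRegretBound t₀ m R := fun r C => by
  have Icc_eq_Ioc : Finset.Icc (t₀ + 1) (t₀ + m) = Finset.Ioc t₀ (t₀ + m) := by
    ext; simp only [Finset.mem_Icc, Finset.mem_Ioc]; omega
  have stepRegret_le := h r C
  rw [Finset.sum_sub_distrib] at stepRegret_le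
  rw [Icc_eq_Ioc]
  linarith [A.expectedCost_le_sum_stepCost r t₀ m]

lemma stepCost_of_subsingleton [Subsingleton (Cache n k)] (A : Algorithm n k) (r : ℕ → Fin n)
    (t : ℕ) (C : Cache n k) : A.stepCost r t = missLoss (r t) C := by
  simp only [stepCost, Subsingleton.elim _ C, transitionCost, moveCost_self, add_zero,
    integral_const, probReal_univ, one_smul]

lemma expectedCost_one_le (A : Algorithm n k) (r : ℕ → Fin n) (t₀ : ℕ) :
    A.expectedCost r t₀ 1 ≤ 2 := by
  have := integral_mono (A.integrable_run (fun C _ => missLoss (r (t₀ + 1)) C) r (t₀ + 1) 0)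
    (integrable_const 2) fun ω => missLoss_le _ _
  simpa [expectedCost, cost] using this

end Algorithm

lemma hasRegretBound_of_multiscale (hkn : k ≤ n) {T : ℕ} (hT : 2 ≤ T) {A : Algorithm n k}
    (hA : ∀ (r : ℕ → Fin n) (j s : ℕ) (C : Cache n k), 2 ^ j ≤ T →
      ∑ t ∈ dyadicBlock j s, (A.stepCost r t - missLoss (r t) C) ≤ blockRegret n k T j + 12 * k)
    {t₀ m : ℕ} (hm : 1 ≤ m) (hmT : m ≤ T) :
    A.HasRegretBound t₀ m (600 * intervalRegret n k T m) := by
  refine .of_sum_stepCost_sub_le fun r C => ?_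
  have dyadic_sum := sum_Ioc_le_of_dyadicBlock (by positivity)
    (fun j s hj => (hA r j s C hj).trans (blockRegret_add_le hT j)) (t₀ := t₀) hm hmT
  linarith [mul_sqrt_le_intervalRegret hkn (one_le_two.trans hT) m, intervalRegret_nonneg n k T m]

lemma hasRegretBound_one_one (hk : 1 ≤ k) (hN : 2 ≤ n.choose k) (A : Algorithm n k) (t₀ : ℕ) :
    A.HasRegretBound t₀ 1 (600 * intervalRegret n k 1 1) := fun r C => by
  have one_le_k : (1 : ℝ) ≤ k := by exact_mod_cast hk
  have half_le : 1 / 2 ≤ intervalRegret n k 1 1 := by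
    simp only [intervalRegret, Nat.cast_one, Real.log_one, mul_zero, Real.sqrt_zero, mul_one,
      zero_add]
    exact Real.le_sqrt_of_sq_le (by nlinarith [half_le_log hN])
  have : 0 ≤ ∑ t ∈ Finset.Icc (t₀ + 1) (t₀ + 1), missLoss (r t) C :=
    Finset.sum_nonneg fun _ _ => missLoss_nonneg _ _
  linarith [A.expectedCost_one_le r t₀]

lemma exists_regret_algorithm (hk : 1 ≤ k) (hkn : k ≤ n) (T : ℕ) (A : Algorithm n k) :
    ∃ X : Algorithm n k,
      (∀ r, ∑ t ∈ Finset.Ioc 0 T, X.stepCost r t ≤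
        ∑ t ∈ Finset.Ioc 0 T, A.stepCost r t + 12 * k) ∧
      ∀ t₀ m, 1 ≤ m → t₀ + m ≤ T → X.HasRegretBound t₀ m (600 * intervalRegret n k T m) := by
  have keep_A (r : ℕ → Fin n) : ∑ t ∈ Finset.Ioc 0 T, A.stepCost r t ≤
      ∑ t ∈ Finset.Ioc 0 T, A.stepCost r t + 12 * k := le_add_of_nonneg_right (by positivity)
  rcases lt_or_ge (n.choose k) 2 with one_cache | many_caches
  · have : Subsingleton (Cache n k) :=
      Fintype.card_le_one_iff_subsingleton.1 (by rw [card_cache]; omega)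
    refine ⟨A, keep_A, fun t₀ m _ _ => .of_sum_stepCost_sub_le fun r C => ?_⟩
    simp only [A.stepCost_of_subsingleton r _ C, sub_self, Finset.sum_const_zero]
    exact mul_nonneg (by norm_num) (intervalRegret_nonneg n k T m)
  rcases lt_or_ge T 2 with short | long
  · refine ⟨A, keep_A, fun t₀ m hm hmT => ?_⟩
    obtain ⟨rfl, rfl⟩ : m = 1 ∧ T = 1 := by omega
    exact hasRegretBound_one_one hk many_caches A t₀
  · obtain ⟨X, hX⟩ := exists_multiscale hk many_caches long A
    exact ⟨X, fun r => (hX r).1, fun t₀ m hm hmT =>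
      hasRegretBound_of_multiscale hkn long (fun r => (hX r).2) hm (by omega)⟩

end Paging

theorem mainTheorem9 :
    ∃ c : ℝ, 0 < c ∧ ∀ n k : ℕ, 1 ≤ k → k ≤ n →
      ∃ A : ℕ → Paging.Algorithm n k,
        Paging.HasCompetitiveRatio A (2 * (harmonic k : ℝ)) ∧
        ∀ T : ℕ, 1 ≤ T → ∀ t₀ m : ℕ, 1 ≤ m → t₀ + m ≤ T →
          (A T).HasRegretBound t₀ m
            (c * ((k : ℝ) * √((m : ℝ) * Real.log (T : ℝ)) +
              √((k : ℝ) * (m : ℝ) * Real.log ((n.choose k : ℝ) * (T : ℝ))))) ∧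
          (k : ℝ) * √((m : ℝ) * Real.log (T : ℝ)) +
              √((k : ℝ) * (m : ℝ) * Real.log ((n.choose k : ℝ) * (T : ℝ))) ≤
            c * ((k : ℝ) * √((m : ℝ) * Real.log ((n : ℝ) * (T : ℝ)))) := by
  refine ⟨600, by norm_num, fun n k hk hkn => ?_⟩
  have : Nonempty (Cache n k) := by
    rw [← Fintype.card_pos_iff, Paging.card_cache]
    exact Nat.choose_pos hkn
  let marking := Paging.marking hk (Classical.arbitrary (Cache n k))
  choose A hA hregret using fun T => Paging.exists_regret_algorithm hk hkn T marking
  refine ⟨A, ⟨harmonic k * (k + 1) + 12 * k, ?_, fun T r S => ?_⟩, fun T hT t₀ m hm hmT =>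
    ⟨hregret T t₀ m hm hmT, ?_⟩⟩
  · have : 1 ≤ harmonic k := Paging.one_le_harmonic hk
    positivity
  · have cost_le := (A T).expectedCost_le_sum_stepCost r 0 T
    rw [zero_add] at cost_le
    linarith [hA T r, Paging.sum_stepCost_marking_le hk (Classical.arbitrary (Cache n k)) r S T]
  · refine (Paging.intervalRegret_le hk hkn hT m).trans ?_
    gcongr
    norm_num
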